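/- **Setting.** Let $(\Omega,\mathcal F)$ be a measurable space and let $\phi:\mathbb R\to[0,+\infty]$ be convex and lower semicontinuous with $\phi(1)=0$, $\phi<+\infty$ in a neighbourhood of $1$, and $\phi=+\infty$ on $(-\infty,0)$. Put $\phi'(\infty)=\lim_{x\to\infty}\phi(x)/x\in[0,+\infty]$, $\psi(x)=\phi(x+1)$, and write $f^\star(y)=\sup_{x\in\mathbb R}\{xy-f(x)\}$ for the convex conjugate of $f:\mathbb R\to[-\infty,+\infty]$ and $\operatorname{dom}f=\{f<+\infty\}$. Write $\mu(h)$ for $\int h\,d\mu$. For probability measures $\mu,\nu$ with Lebesgue decomposition $\mu=\mu_c+\mu_s$, $\mu_c\ll\nu$, $\mu_s\perp\nu$, let $$D(\mu\|\nu)=\nu\Bigl(\phi\bigl(\tfrac{d\mu_c}{d\nu}\bigr)\Bigr)+\mu_s(\Omega)\,\phi'(\infty)\qquad(0\cdot\infty=0).$$ For a vector space $X$ of finite signed measures let $\Xi=\{A\in\mathcal F:|\mu|(A)=0\ \forall\mu\in X\}$ be its null $\sigma$-ideal. For a finite non-negative measure $\nu\in X$ and a vector space $Y$ of real measurable functions modulo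 $\Xi$, the pair $(X,Y)$ is *$\nu$-decomposable* if: (1) every $h\in Y$ is integrable for every $\mu\in X$ and $(\mu,h)\mapsto\mu(h)$ puts $X$ and $Y$ in separating duality; (2) $X$ contains all $\mu\ll\nu$ with $\frac{d\mu}{d\nu}\in L^\infty(\nu)$, and $Y$ contains all functions with bounded $\Xi$-essential range; (3) for every measurable $A\notin\Xi$ there is a non-zero non-negative $\mu\in X$ with $\mu(\Omega\setminus A)=0$. Here the $\Xi$-essential range of $f$ is $\{x\in\mathbb R: f^{-1}((x-\delta,x+\delta))\notin\Xi\ \forall\delta>0\}$, and $\operatorname{ess\,sup}_\Xi f\in[-\infty,+\infty]$ is its supremum. Let $X^1$ be the set of probability measures in $X$, and define for $\varepsilon,t\in\mathbb R$ $$\mathscr L_{g,\nu}(\varepsilon)=\inf\{D(\mu\|\nu):\mu\in X^1,\ \mu(g)-\nu(g)=\varepsilon\},$$ $$K_{g,\nu,\Xi}(t)=\inf\{\nu(\psi^\star(tg+\lambda)):\lambda\in\mathbb R,\ \lambda+\operatorname{ess\,sup}_\Xi(tg)\le\phi'(\infty)\}.$$ *Strong duality holds at $\varepsilon$* if $\mathscr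 L_{g,\nu}(\varepsilon)=\sup_{t\in\mathbb R}\bigl\{t\varepsilon-\sup_{\mu\in X^1}\{t(\mu(g)-\nu(g))-D(\mu\|\nu)\}\bigr\}$. **Theorem.** Let $\nu$ be a probability measure. (A) Let $(X,Y)$ be $\nu$-decomposable and $g\in Y$. Then: 1. for all $t\in\mathbb R$, $\mathscr L_{g,\nu}^\star(t)=\inf\{\nu(\phi^\star(tg+\lambda))-t\,\nu(g)-\lambda:\lambda\in\mathbb R,\ \lambda+\operatorname{ess\,sup}_\Xi(tg)\le\phi'(\infty)\}=K_{g,\nu,\Xi}(t)$; 2. for all $\varepsilon\in\mathbb R$, $\mathscr L_{g,\nu}(\varepsilon)=\mathscr L_{g,\nu}^{\star\star}(\varepsilon)$ if and only if strong duality holds at $\varepsilon$; 3. $\mathscr L_{g,\nu}(\varepsilon)=K_{g,\nu,\Xi}^\star(\varepsilon)$ for all $\varepsilon$ in the interior of $\operatorname{dom}\mathscr L_{g,\nu}$; 4. $\mathscr L_{g,\nu}$ is lower semicontinuous if and only if strong duality holds at every $\varepsilon\in\mathbb R$, and in that case $\mathscr L_{g,\nu}(\varepsilon)=K_{g,\nu,\Xi}^\star(\varepsilon)$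 for all $\varepsilon\in\mathbb R$. (B) Let $\Sigma\subseteq\mathcal F$ be a $\sigma$-ideal, $g:\Omega\to\mathbb R$ measurable, $X_g$ the set of finite signed measures $\mu$ with $|\mu|(A)=0$ for all $A\in\Sigma$ and $|\mu|(|g|)<\infty$, and $\Xi$ the null $\sigma$-ideal of $X_g$. If $\nu\in X_g$, then for every convex lower semicontinuous $L:\mathbb R\to[0,+\infty]$ the following are equivalent: (i) $D(\mu\|\nu)\ge L(\mu(g)-\nu(g))$ for every probability measure $\mu\in X_g$; (ii) $K_{g,\nu,\Xi}(t)\le L^\star(t)$ for all $t\in\mathbb R$. -/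

import Mathlib

open MeasureTheory Set Filter Topology
open scoped ENNReal

noncomputable section

/-! ### Extended-real-valued functions on the line -/

/-- Convexity of an extended-real-valued function on the line: its epigraph is convex. -/
def ConvexERealFun (f : ℝ → EReal) : Prop :=
  Convex ℝ {p : ℝ × ℝ | f p.1 ≤ (p.2 : EReal)}

/-- The effective domain `{x | f x < +∞}`. -/
def effDomain (f : ℝ → EReal) : Set ℝ := {x | f x < ⊤}

/-- The convex conjugate `f*(y) = sup_x (x y - f x)`. -/
def convexConj (f : ℝ → EReal) (y : ℝ) : EReal :=
  ⨆ x : ℝ, (((x * y : ℝ) : EReal) - f x)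

/-- The slope at infinity `f'(∞) = lim_{x → ∞} f x / x`. For a convex function that is proper
the limit exists in the extended reals, so it is the upper limit. -/
def slopeAtTop (f : ℝ → EReal) : EReal :=
  limsup (fun x : ℝ => f x / (x : EReal)) atTop

/-- The functions `φ` generating a divergence: convex, lower semicontinuous, with `φ 1 = 0`,
finite in a neighbourhood of `1`, and normalized so that `φ` is nonnegative and is `+∞` on the
negative reals. -/
structure IsDivergenceFunction (φ : ℝ → EReal) : Prop where
  convex : ConvexERealFun φ
  lsc : LowerSemicontinuous φ
  one : φ 1 = 0
  finite_near_one : ∀ᶠ x in 𝓝 (1 : ℝ), φ x < ⊤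
  nonneg : ∀ x, 0 ≤ φ x
  neg_eq_top : ∀ x < 0, φ x = ⊤

variable {Ω : Type*} [MeasurableSpace Ω]

/-! ### Integrals -/

/-- The integral of an extended-real-valued function, positive part minus negative part. It is
used only for functions whose negative part has finite integral. -/
def extIntegral (ν : Measure Ω) (f : Ω → EReal) : EReal :=
  ((∫⁻ ω, (f ω).toENNReal ∂ν : ℝ≥0∞) : EReal) - ((∫⁻ ω, (-f ω).toENNReal ∂ν : ℝ≥0∞) : EReal)

/-- The integral `μ(h)` of a real function against a finite signed measure. -/
def signedIntegral (μ : SignedMeasure Ω) (h : Ω → ℝ) : ℝ :=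
  ∫ ω, h ω ∂μ.toJordanDecomposition.posPart - ∫ ω, h ω ∂μ.toJordanDecomposition.negPart

/-- The `φ`-divergence `D(μ‖ν) = ν(φ(dμ_c/dν)) + μ_s(Ω) φ'(∞)` of a nonnegative measure `μ` with
respect to `ν`, where `μ = μ_c + μ_s` is the Lebesgue decomposition of `μ` with respect to `ν`. -/
def phiDivergence (φ : ℝ → EReal) (μ ν : Measure Ω) : EReal :=
  extIntegral ν (fun ω => φ (μ.rnDeriv ν ω).toReal)
    + ((μ.singularPart ν univ : ℝ≥0∞) : EReal) * slopeAtTop φ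

/-! ### σ-ideals, essential range, decomposable pairs -/

/-- `S` is a σ-ideal of the σ-algebra of measurable sets. -/
structure IsSigmaIdeal (S : Set (Set Ω)) : Prop where
  measurableSet : ∀ A ∈ S, MeasurableSet A
  empty_mem : ∅ ∈ S
  subset_mem : ∀ A ∈ S, ∀ B, MeasurableSet B → B ⊆ A → B ∈ S
  iUnion_mem : ∀ A : ℕ → Set Ω, (∀ n, A n ∈ S) → (⋃ n, A n) ∈ S

/-- The σ-ideal of the measurable sets that are null for all signed measures in `X`. -/
def nullIdeal (X : Set (SignedMeasure Ω)) : Set (Set Ω) :=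
  {A | MeasurableSet A ∧ ∀ μ ∈ X, μ.totalVariation A = 0}

/-- The essential range of `f` with respect to `S`. -/
def essRange (S : Set (Set Ω)) (f : Ω → ℝ) : Set ℝ :=
  {x | ∀ δ > 0, f ⁻¹' Ioo (x - δ) (x + δ) ∉ S}

/-- The essential supremum of `f` with respect to `S`: the supremum, in the extended reals, of
its essential range. -/
def essSupIdeal (S : Set (Set Ω)) (f : Ω → ℝ) : EReal :=
  sSup ((fun x : ℝ => (x : EReal)) '' essRange S f)

/-- The probability measures that belong to a set `X` of signed measures. -/
def probMeasures (X : Set (SignedMeasure Ω)) : Set (ProbabilityMeasure Ω) :=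
  {μ | (μ : Measure Ω).toSignedMeasure ∈ X}

/-- The pair `(X, Y)` is `ν`-decomposable. `X` is a vector space of finite signed measures, and
with `Ξ` the null σ-ideal of `X`, the vector space `Y` of functions modulo `Ξ` is represented by
the space of all measurable functions whose classes belong to it. -/
structure IsDecomposable (X : Submodule ℝ (SignedMeasure Ω)) (Y : Submodule ℝ (Ω → ℝ))
    (ν : Measure Ω) [IsFiniteMeasure ν] : Prop where
  mem : ν.toSignedMeasure ∈ X
  measurable : ∀ h ∈ Y, Measurable h
  integrable : ∀ μ ∈ X, ∀ h ∈ Y, Integrable h μ.totalVariation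
  separating_left : ∀ μ ∈ X, μ ≠ 0 → ∃ h ∈ Y, signedIntegral μ h ≠ 0
  separating_right : ∀ h ∈ Y, {ω | h ω ≠ 0} ∉ nullIdeal (X : Set (SignedMeasure Ω)) →
    ∃ μ ∈ X, signedIntegral μ h ≠ 0
  density_mem : ∀ f : Ω → ℝ, MemLp f ⊤ ν → ν.withDensityᵥ f ∈ X
  bounded_mem : ∀ h : Ω → ℝ, Measurable h →
    Bornology.IsBounded (essRange (nullIdeal (X : Set (SignedMeasure Ω))) h) → h ∈ Y
  exists_concentrated : ∀ A, MeasurableSet A → A ∉ nullIdeal (X : Set (SignedMeasure Ω)) →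
    ∃ μ ∈ X, 0 ≤ μ ∧ μ ≠ 0 ∧ μ Aᶜ = 0

/-- The finite signed measures `μ` vanishing on all elements of `S` with `|μ|(|g|) < ∞`. -/
def integratingMeasures (S : Set (Set Ω)) (g : Ω → ℝ) : Set (SignedMeasure Ω) :=
  {μ | (∀ A ∈ S, μ.totalVariation A = 0) ∧ Integrable g μ.totalVariation}

/-! ### Optimal lower bound, strong duality, cumulant generating function -/

/-- The optimal lower bound `inf {D(μ‖ν) | μ ∈ M, μ(g) - ν(g) = ε}`. -/
def optLowerBound (φ : ℝ → EReal) (M : Set (ProbabilityMeasure Ω)) (g : Ω → ℝ) (ν : Measure Ω)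
    (ε : ℝ) : EReal :=
  ⨅ (μ : ProbabilityMeasure Ω) (_ : μ ∈ M)
    (_ : ∫ ω, g ω ∂(μ : Measure Ω) - ∫ ω, g ω ∂ν = ε), phiDivergence φ (μ : Measure Ω) ν

/-- The value of the problem dual to the one that defines the optimal lower bound,
`sup_t (t ε - sup_{μ ∈ M} (t (μ(g) - ν(g)) - D(μ‖ν)))`. -/
def dualValue (φ : ℝ → EReal) (M : Set (ProbabilityMeasure Ω)) (g : Ω → ℝ) (ν : Measure Ω)
    (ε : ℝ) : EReal :=
  ⨆ t : ℝ, (((t * ε : ℝ) : EReal) - ⨆ (μ : ProbabilityMeasure Ω) (_ : μ ∈ M),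
    (((t * (∫ ω, g ω ∂(μ : Measure Ω) - ∫ ω, g ω ∂ν) : ℝ) : EReal)
      - phiDivergence φ (μ : Measure Ω) ν))

/-- Strong duality at `ε`: the primal and the dual problem have the same value. -/
def StrongDualityAt (φ : ℝ → EReal) (M : Set (ProbabilityMeasure Ω)) (g : Ω → ℝ)
    (ν : Measure Ω) (ε : ℝ) : Prop :=
  optLowerBound φ M g ν ε = dualValue φ M g ν ε

/-- The `(φ, ν, S)`-cumulant generating function
`t ↦ inf {ν(ψ*(t g + l)) | l + esssup_S (t g) ≤ φ'(∞)}`, where `ψ x = φ (x + 1)`. -/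
def cumulantGF (φ : ℝ → EReal) (ν : Measure Ω) (S : Set (Set Ω)) (g : Ω → ℝ) (t : ℝ) : EReal :=
  ⨅ (l : ℝ) (_ : (l : EReal) + essSupIdeal S (fun ω => t * g ω) ≤ slopeAtTop φ),
    extIntegral ν (fun ω => convexConj (fun x => φ (x + 1)) (t * g ω + l))

end

open scoped NNReal

section

variable {Ω : Type*} [MeasurableSpace Ω]

/-! The core is a Lagrange duality in which only the constraint that the total mass be 1 is
dualized: for f = t g, the supremum of μ(f) - ν(f) - D(μ‖ν) over probability measures equals the
infimum of ν(ψ*(f + λ)) over admissible λ (`iSup_sub_phiDivergence_eq`).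

The inequality ≤ is Fenchel-Young: (x - 1) y ≤ φ(x) + ψ*(y) with x the density, and f + λ ≤ φ'(∞) on
the singular part (`integral_sub_integral_le`). For ≥, the pairs (mass, upper bound of D - μ(f))
form a convex set in the plane; since φ is finite near 1, its points have abscissas on both sides of
1, and the slope of a supporting line there is λ (`exists_multiplier`). Inserting test measures into
the resulting inequality gives the rest: adding to ν large multiples of measures concentrated where
f is near an essential value forces λ + ess sup f ≤ φ'(∞) (`add_essSupIdeal_le`), and densities that
nearly maximize (x - 1)(f + λ) - φ(x) pointwise bring in ψ* (`lintegral_shiftConj_le`).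

The left side is the conjugate of the optimal lower bound, so the dual value is its biconjugate. The
optimal lower bound is convex and nonnegative, hence equals its biconjugate on the interior of its
domain, and everywhere if it is lower semicontinuous. Part (B) follows because conjugation reverses
order and L = L**. Both parts use only the properties collected in `IsAdmissibleCone`. -/

/-! ### Convex conjugates and biconjugates on the line -/

theorem EReal.exists_coe_of_nonneg_of_lt_top {x : EReal} (h0 : 0 ≤ x) (h : x < ⊤) :
    ∃ a : ℝ, 0 ≤ a ∧ x = a := by
  induction x with
  | bot => simp at h0
  | top => simp at h
  | coe a => exact ⟨a, by exact_mod_cast h0, rfl⟩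

/-- Quantifying over real upper bounds `a` of `f x` treats infinite values uniformly: `⊤` has no
such bound and `⊥` has all of them. -/
theorem convexConj_le_iff {f : ℝ → EReal} {y : ℝ} {c : EReal} :
    convexConj f y ≤ c ↔ ∀ x a : ℝ, f x ≤ (a : EReal) → ((x * y - a : ℝ) : EReal) ≤ c := by
  unfold convexConj
  rw [iSup_le_iff]
  refine forall_congr' fun x => ?_
  constructor
  · intro h a ha
    refine le_trans ?_ h
    rw [EReal.coe_sub]
    exact EReal.sub_le_sub le_rfl ha
  · intro h
    generalize hfx : f x = u at h
    induction u with
    | bot =>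
      have : c = ⊤ := by
        rw [EReal.eq_top_iff_forall_lt]
        intro r
        refine lt_of_lt_of_le ?_ (h (x * y - (r + 1)) bot_le)
        exact_mod_cast (by linarith : r < x * y - (x * y - (r + 1)))
      simp [this]
    | top => simp
    | coe a => exact_mod_cast h a le_rfl

theorem le_convexConj {f : ℝ → EReal} {x a : ℝ} (h : f x ≤ (a : EReal)) (y : ℝ) :
    ((x * y - a : ℝ) : EReal) ≤ convexConj f y :=
  convexConj_le_iff.1 le_rfl x a h

theorem convexConj_anti {f g : ℝ → EReal} (h : ∀ x, f x ≤ g x) (y : ℝ) :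
    convexConj g y ≤ convexConj f y :=
  iSup_mono fun x => EReal.sub_le_sub le_rfl (h x)

theorem biconj_le (f : ℝ → EReal) (x : ℝ) : convexConj (convexConj f) x ≤ f x := by
  rw [convexConj_le_iff]
  intro t a ha
  rw [convexConj_le_iff] at ha
  rw [← EReal.le_of_forall_lt_iff_le]
  intro z hz
  have h := ha x z hz.le
  norm_cast at h ⊢
  linarith [mul_comm x t]

theorem lowerSemicontinuous_convexConj (f : ℝ → EReal) : LowerSemicontinuous (convexConj f) := by
  unfold convexConj
  refine lowerSemicontinuous_iSup fun x => ?_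
  induction f x with
  | bot =>
    simp_rw [EReal.coe_sub_bot]
    exact lowerSemicontinuous_const
  | top =>
    simp_rw [EReal.sub_top]
    exact lowerSemicontinuous_const
  | coe a =>
    refine Continuous.lowerSemicontinuous ?_
    simp_rw [← EReal.coe_sub]
    have h : Continuous fun y : ℝ => x * y - a := by fun_prop
    exact continuous_coe_real_ereal.comp h

/-- An affine function below `f` is below its biconjugate. -/
theorem le_biconj_of_affine {f : ℝ → EReal} {s k : ℝ}
    (h : ∀ x a : ℝ, f x ≤ (a : EReal) → s * x + k ≤ a) (x : ℝ) :
    ((s * x + k : ℝ) : EReal) ≤ convexConj (convexConj f) x := by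
  have h1 : convexConj f s ≤ ((-k : ℝ) : EReal) := by
    rw [convexConj_le_iff]
    intro x a ha
    have := h x a ha
    norm_cast
    linarith [mul_comm s x]
  simpa using le_convexConj h1 x

/-- A convex set of the plane has a nonvertical supporting line at a point on the lower boundary
of its section over an inner abscissa. -/
theorem exists_supporting_line {E : Set (ℝ × ℝ)} (hE : Convex ℝ E) {x₀ v : ℝ}
    (h : ∀ y, (x₀, y) ∈ E → v ≤ y) (hl : ∃ p ∈ E, p.1 < x₀) (hr : ∃ q ∈ E, x₀ < q.1) :
    ∃ l : ℝ, ∀ p ∈ E, v + l * (p.1 - x₀) ≤ p.2 := by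
  have key : ∀ p ∈ E, ∀ q ∈ E, p.1 < x₀ → x₀ < q.1 →
      (v - p.2) / (x₀ - p.1) ≤ (q.2 - v) / (q.1 - x₀) := by
    intro p hp q hq hpx hqx
    have hd : 0 < q.1 - p.1 := by linarith
    have hm := h (((q.1 - x₀) / (q.1 - p.1)) * p.2 + ((x₀ - p.1) / (q.1 - p.1)) * q.2) (by
      have := hE hp hq (a := (q.1 - x₀) / (q.1 - p.1)) (b := (x₀ - p.1) / (q.1 - p.1))
        (div_nonneg (by linarith) hd.le) (div_nonneg (by linarith) hd.le)
        (by field_simp; ring)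
      convert this using 1
      ext
      · simp; field_simp; ring
      · simp)
    rw [div_le_div_iff₀ (by linarith) (by linarith)]
    have hm' : v * (q.1 - p.1) ≤ (q.1 - x₀) * p.2 + (x₀ - p.1) * q.2 := by
      have := mul_le_mul_of_nonneg_right hm hd.le
      refine this.trans (le_of_eq ?_)
      field_simp
    nlinarith
  obtain ⟨p₀, hp₀, hp₀x⟩ := hl
  obtain ⟨q₀, hq₀, hq₀x⟩ := hr
  obtain ⟨l, hl1, hl2⟩ := exists_between_of_forall_le
    (s := {z | ∃ p ∈ E, p.1 < x₀ ∧ z = (v - p.2) / (x₀ - p.1)})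
    (t := {z | ∃ q ∈ E, x₀ < q.1 ∧ z = (q.2 - v) / (q.1 - x₀)})
    ⟨_, p₀, hp₀, hp₀x, rfl⟩ ⟨_, q₀, hq₀, hq₀x, rfl⟩ (by
      rintro _ ⟨p, hp, hpx, rfl⟩ _ ⟨q, hq, hqx, rfl⟩
      exact key p hp q hq hpx hqx)
  refine ⟨l, fun p hp => ?_⟩
  rcases lt_trichotomy p.1 x₀ with hlt | heq | hgt
  · have := hl1 ⟨p, hp, hlt, rfl⟩
    rw [div_le_iff₀ (by linarith)] at this
    linarith
  · have := h p.2 (by rw [← heq]; exact hp)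
    rw [heq]; linarith
  · have := hl2 ⟨p, hp, hgt, rfl⟩
    rw [le_div_iff₀ (by linarith)] at this
    linarith

theorem biconj_eq_of_mem_interior {f : ℝ → EReal} (hf : ConvexERealFun f) (h0 : ∀ x, 0 ≤ f x)
    {x₀ : ℝ} (hx : x₀ ∈ interior (effDomain f)) : f x₀ = convexConj (convexConj f) x₀ := by
  refine le_antisymm ?_ (biconj_le f x₀)
  have hfin : f x₀ < ⊤ := (interior_subset hx : x₀ ∈ effDomain f)
  obtain ⟨v, -, hv⟩ := EReal.exists_coe_of_nonneg_of_lt_top (h0 x₀) hfin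
  obtain ⟨δ, hδ, hball⟩ := Metric.mem_nhds_iff.1 (mem_interior_iff_mem_nhds.1 hx)
  have hmem : ∀ z, |z - x₀| < δ → ∃ a : ℝ, f z ≤ a := fun z hz => by
    obtain ⟨a, -, ha⟩ := EReal.exists_coe_of_nonneg_of_lt_top (h0 z)
      (hball (by simpa [Real.dist_eq] using hz) : f z < ⊤)
    exact ⟨a, ha.le⟩
  obtain ⟨a, ha⟩ := hmem (x₀ - δ / 2) (by rw [sub_sub_cancel_left, abs_neg, abs_of_pos] <;> linarith)
  obtain ⟨b, hb⟩ := hmem (x₀ + δ / 2) (by rw [add_sub_cancel_left, abs_of_pos] <;> linarith)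
  obtain ⟨l, hl⟩ := exists_supporting_line hf (x₀ := x₀) (v := v)
    (fun y hy => by
      have : f x₀ ≤ (y : EReal) := hy
      rw [hv] at this; exact_mod_cast this)
    ⟨(x₀ - δ / 2, a), ha, by simp; linarith⟩ ⟨(x₀ + δ / 2, b), hb, by simp; linarith⟩
  have := le_biconj_of_affine (f := f) (s := l) (k := v - l * x₀)
    (fun x a hxa => by have := hl (x, a) hxa; simp only at this; linarith) x₀
  rw [hv]
  simpa using this

theorem biconj_eq_of_lowerSemicontinuous {f : ℝ → EReal} (hf : ConvexERealFun f)
    (hlsc : LowerSemicontinuous f) (h0 : ∀ x, 0 ≤ f x) (x₀ : ℝ) :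
    f x₀ = convexConj (convexConj f) x₀ := by
  refine le_antisymm ?_ (biconj_le f x₀)
  rw [← EReal.ge_of_forall_gt_iff_ge]
  intro c hc
  -- If `f` is identically `⊤`, every constant is an affine minorant.
  by_cases hne : ∃ x a : ℝ, f x ≤ (a : EReal)
  swap
  · push Not at hne
    refine le_trans (le_of_eq ?_) (le_biconj_of_affine (f := f) (s := 0) (k := c)
      (fun x a hxa => absurd hxa (hne x a).not_ge) x₀)
    simp
  obtain ⟨x₁, a₁, h₁⟩ := hne
  have hclosed : IsClosed {p : ℝ × ℝ | f p.1 ≤ (p.2 : EReal)} := by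
    have := hlsc.isClosed_epigraph
    exact this.preimage (f := fun p : ℝ × ℝ => (p.1, (p.2 : EReal)))
      (continuous_fst.prodMk (continuous_coe_real_ereal.comp continuous_snd))
  obtain ⟨φ, u, hu1, hu2⟩ := geometric_hahn_banach_point_closed (x := ((x₀, c) : ℝ × ℝ)) hf hclosed
    (by simpa using hc)
  set α := φ (1, 0)
  set β := φ (0, 1)
  have hφ : ∀ x y : ℝ, φ (x, y) = α * x + β * y := by
    intro x y
    have : ((x, y) : ℝ × ℝ) = x • ((1, 0) : ℝ × ℝ) + y • ((0, 1) : ℝ × ℝ) := by simp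
    rw [this, map_add, map_smul, map_smul]
    simp only [smul_eq_mul]
    ring
  rw [hφ] at hu1
  have hu2' : ∀ x a : ℝ, f x ≤ (a : EReal) → u < α * x + β * a := fun x a h => by
    rw [← hφ]; exact hu2 (x, a) h
  -- The epigraph is unbounded upwards over `x₁`, which a negative `β` would contradict.
  have hβ : 0 ≤ β := by
    by_contra hneg
    push Not at hneg
    have hbig := hu2' x₁ (max a₁ ((u - α * x₁) / β))
      (h₁.trans (by exact_mod_cast le_max_left _ _))
    have h2 : β * max a₁ ((u - α * x₁) / β) ≤ β * ((u - α * x₁) / β) :=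
      mul_le_mul_of_nonpos_left (le_max_right _ _) hneg.le
    rw [mul_div_cancel₀ _ hneg.ne] at h2
    linarith
  rcases hβ.lt_or_eq with hpos | hzero
  · have := le_biconj_of_affine (f := f) (s := -α / β) (k := u / β) (fun x a h => by
      have h2 := hu2' x a h
      have : -α / β * x + u / β = (u - α * x) / β := by ring
      rw [this, div_le_iff₀ hpos]
      linarith) x₀
    refine le_trans ?_ this
    have : -α / β * x₀ + u / β = (u - α * x₀) / β := by ring
    rw [this]
    norm_cast
    rw [le_div_iff₀ hpos]
    linarith
  -- The separating line is vertical. Since `f ≥ 0` and `u - α x < 0` on the domain, every multiple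
  -- `n (u - α x)` with `n ≥ 0` is a minorant, and it is as large as desired at `x₀`.
  · rw [← hzero] at hu1 hu2'
    have hgap : 0 < u - α * x₀ := by linarith
    set n : ℝ := max 0 (c / (u - α * x₀))
    have := le_biconj_of_affine (f := f) (s := -(n * α)) (k := n * u) (fun x a h => by
      have h2 := hu2' x a h
      have ha : 0 ≤ a := by exact_mod_cast (h0 x).trans h
      have : n * (u - α * x) ≤ 0 :=
        mul_nonpos_of_nonneg_of_nonpos (le_max_left _ _) (by linarith)
      linarith) x₀
    refine le_trans ?_ this
    norm_cast
    have h3 : c / (u - α * x₀) * (u - α * x₀) ≤ n * (u - α * x₀) :=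
      mul_le_mul_of_nonneg_right (le_max_right _ _) hgap.le
    rw [div_mul_cancel₀ _ hgap.ne'] at h3
    linarith

theorem ConvexERealFun.le_combo {f : ℝ → EReal} (hf : ConvexERealFun f) {x y u w a b : ℝ}
    (hx : f x ≤ (u : EReal)) (hy : f y ≤ (w : EReal)) (ha : 0 ≤ a) (hb : 0 ≤ b)
    (hab : a + b = 1) : f (a * x + b * y) ≤ ((a * u + b * w : ℝ) : EReal) := by
  simpa using hf (x := (x, u)) hx (y := (y, w)) hy ha hb hab

/-! ### Growth and convexity of divergence functions -/

namespace IsDivergenceFunction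

variable {φ : ℝ → EReal} (hφ : IsDivergenceFunction φ)

include hφ

theorem measurable_toENNReal : Measurable fun x => (φ x).toENNReal :=
  hφ.lsc.measurable.ereal_toENNReal

theorem toENNReal_combo_le (x y : ℝ) {a b : ℝ≥0} (ha : a ≠ 0) (hb : b ≠ 0) (hab : a + b = 1) :
    (φ (a * x + b * y)).toENNReal ≤ a * (φ x).toENNReal + b * (φ y).toENNReal := by
  by_cases hx : φ x = ⊤
  · simp [hx, ha]
  by_cases hy : φ y = ⊤
  · simp [hy, hb]
  obtain ⟨u, hu0, hu⟩ := EReal.exists_coe_of_nonneg_of_lt_top (hφ.nonneg x) (lt_top_iff_ne_top.2 hx)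
  obtain ⟨w, hw0, hw⟩ := EReal.exists_coe_of_nonneg_of_lt_top (hφ.nonneg y) (lt_top_iff_ne_top.2 hy)
  refine (EReal.toENNReal_le_toENNReal (hφ.convex.le_combo hu.le hw.le a.coe_nonneg b.coe_nonneg
    (by exact_mod_cast hab))).trans (le_of_eq ?_)
  rw [hu, hw, EReal.real_coe_toENNReal, EReal.real_coe_toENNReal, EReal.real_coe_toENNReal,
    ENNReal.ofReal_add (mul_nonneg a.coe_nonneg hu0) (mul_nonneg b.coe_nonneg hw0), ENNReal.ofReal_mul a.coe_nonneg,
    ENNReal.ofReal_mul b.coe_nonneg]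
  simp

/-- For large `z` the point `1 + x` lies between `1`, where `φ` vanishes, and `z + 1`, where `φ` is
at most `c (z + 1)`. The chord gives the bound `c x + c x / z`, and `z → ∞`. -/
theorem one_add_le_of_slopeAtTop_lt {c x : ℝ} (hc : slopeAtTop φ < (c : EReal)) (hx : 0 ≤ x) :
    φ (1 + x) ≤ ((c * x : ℝ) : EReal) := by
  have hev : ∀ᶠ z : ℝ in atTop, φ z / (z : EReal) < (c : EReal) := eventually_lt_of_limsup_lt hc
  have hev2 : ∀ᶠ z : ℝ in atTop, φ (1 + x) ≤ ((c * x + c * x / z : ℝ) : EReal) := by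
    have hsh : Tendsto (fun z : ℝ => z + 1) atTop atTop := tendsto_atTop_add_const_right _ _ tendsto_id
    filter_upwards [hsh.eventually hev, eventually_ge_atTop (max x 1)] with z hz hzx
    have hz1 : 1 ≤ z := (le_max_right _ _).trans hzx
    have hzx : x ≤ z := (le_max_left _ _).trans hzx
    rw [EReal.div_lt_iff (by exact_mod_cast (by linarith : 0 < z + 1)) (EReal.coe_ne_top _)] at hz
    have h1 : φ (z + 1) ≤ ((c * (z + 1) : ℝ) : EReal) := by
      rw [EReal.coe_mul]; exact hz.le
    have h2 := hφ.convex.le_combo (x := 1) (u := 0) (by simp [hφ.one]) h1 (a := 1 - x / z)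
      (b := x / z) (by rw [sub_nonneg, div_le_one (by linarith)]; exact hzx) (by positivity) (by ring)
    have e1 : (1 - x / z) * 1 + x / z * (z + 1) = 1 + x := by field_simp; ring
    have e2 : (1 - x / z) * 0 + x / z * (c * (z + 1)) = c * x + c * x / z := by field_simp; ring
    rwa [e1, e2] at h2
  have hlim : Tendsto (fun z : ℝ => ((c * x + c * x / z : ℝ) : EReal)) atTop
      (𝓝 ((c * x : ℝ) : EReal)) := by
    have h : Tendsto (fun z : ℝ => c * x + c * x / z) atTop (𝓝 (c * x + 0)) :=
      tendsto_const_nhds.add (tendsto_const_nhds.div_atTop tendsto_id)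
    rw [add_zero] at h
    exact (continuous_coe_real_ereal.tendsto _).comp h
  exact ge_of_tendsto hlim hev2

theorem slopeAtTop_nonneg : 0 ≤ slopeAtTop φ := by
  refine le_limsup_of_frequently_le (Eventually.frequently ?_)
  filter_upwards [eventually_gt_atTop 0] with z hz
  exact EReal.div_nonneg (hφ.nonneg z) (by exact_mod_cast hz.le)

theorem toENNReal_one_add_le {x : ℝ} (hx : 0 ≤ x) :
    (φ (1 + x)).toENNReal ≤ ENNReal.ofReal x * (slopeAtTop φ).toENNReal := by
  rcases hx.eq_or_lt with rfl | hx
  · simp [hφ.one]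
  by_cases htop : slopeAtTop φ = ⊤
  · simp [htop, ENNReal.mul_top, hx]
  obtain ⟨κ, hκ0, hκ⟩ := EReal.exists_coe_of_nonneg_of_lt_top hφ.slopeAtTop_nonneg
    (lt_top_iff_ne_top.2 htop)
  have : φ (1 + x) ≤ ((κ * x : ℝ) : EReal) := by
    rw [← EReal.le_of_forall_lt_iff_le]
    intro z hz
    have hz' : κ < z / x := by rw [lt_div_iff₀ hx]; exact_mod_cast hz
    have := hφ.one_add_le_of_slopeAtTop_lt (c := z / x) (by rw [hκ]; exact_mod_cast hz') hx.le
    rwa [div_mul_cancel₀ _ hx.ne'] at this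
  refine (EReal.toENNReal_le_toENNReal this).trans (le_of_eq ?_)
  rw [hκ, EReal.real_coe_toENNReal, EReal.real_coe_toENNReal, ENNReal.ofReal_mul hκ0, mul_comm]

end IsDivergenceFunction

/-! ### The divergence as a functional of the measure -/

theorem extIntegral_of_nonneg (ν : Measure Ω) {f : Ω → EReal} (hf : ∀ ω, 0 ≤ f ω) :
    extIntegral ν f = ((∫⁻ ω, (f ω).toENNReal ∂ν : ℝ≥0∞) : EReal) := by
  have : ∀ ω, (-f ω).toENNReal = 0 := fun ω => EReal.toENNReal_of_nonpos (by simpa using hf ω)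
  simp [extIntegral, this]

/-- The `φ`-divergence with values in `[0, ∞]`. -/
noncomputable def divergence (φ : ℝ → EReal) (μ ν : Measure Ω) : ℝ≥0∞ :=
  ∫⁻ ω, (φ (μ.rnDeriv ν ω).toReal).toENNReal ∂ν + μ.singularPart ν univ * (slopeAtTop φ).toENNReal

theorem divergence_smul_self (φ : ℝ → EReal) (ν : Measure Ω) [IsProbabilityMeasure ν] (c : ℝ≥0) :
    divergence φ (c • ν) ν = (φ c).toENNReal := by
  have : ∫⁻ ω, (φ ((c • ν).rnDeriv ν ω).toReal).toENNReal ∂ν = ∫⁻ _, (φ c).toENNReal ∂ν := by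
    refine lintegral_congr_ae ?_
    filter_upwards [Measure.rnDeriv_smul_left ν ν c, Measure.rnDeriv_self ν] with ω h h'
    rw [h, Pi.smul_apply, h', ENNReal.smul_def]
    simp
  unfold divergence
  rw [this, Measure.singularPart_smul, Measure.singularPart_self]
  simp

theorem divergence_withDensity (φ : ℝ → EReal) (ν : Measure Ω) [IsFiniteMeasure ν] {r : Ω → ℝ} (hr : Measurable r)
    (h0 : ∀ ω, 0 ≤ r ω) :
    divergence φ (ν.withDensity fun ω => ENNReal.ofReal (r ω)) ν
      = ∫⁻ ω, (φ (r ω)).toENNReal ∂ν := by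
  have : ∫⁻ ω, (φ ((ν.withDensity fun ω => ENNReal.ofReal (r ω)).rnDeriv ν ω).toReal).toENNReal ∂ν
      = ∫⁻ ω, (φ (r ω)).toENNReal ∂ν := by
    refine lintegral_congr_ae ?_
    filter_upwards [Measure.rnDeriv_withDensity ν hr.ennreal_ofReal] with ω h
    rw [h, ENNReal.toReal_ofReal (h0 ω)]
  unfold divergence
  rw [this, Measure.singularPart_withDensity]
  simp

section Divergence

variable {φ : ℝ → EReal} (hφ : IsDivergenceFunction φ) (μ μ' ν : Measure Ω)

include hφ

theorem phiDivergence_eq_divergence : phiDivergence φ μ ν = (divergence φ μ ν : EReal) := by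
  rw [phiDivergence, divergence, extIntegral_of_nonneg ν fun ω => hφ.nonneg _,
    EReal.coe_ennreal_add, EReal.coe_ennreal_mul, EReal.coe_toENNReal hφ.slopeAtTop_nonneg]

/-- The Lebesgue decomposition is linear in the measure, so convexity of `φ` handles the density and
the singular part contributes linearly. -/
theorem divergence_combo_le [IsFiniteMeasure μ] [IsFiniteMeasure μ'] [IsFiniteMeasure ν]
    {a b : ℝ≥0} (ha : a ≠ 0) (hb : b ≠ 0) (hab : a + b = 1) :
    divergence φ (a • μ + b • μ') ν ≤ a * divergence φ μ ν + b * divergence φ μ' ν := by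
  have h1 : ∫⁻ ω, (φ ((a • μ + b • μ').rnDeriv ν ω).toReal).toENNReal ∂ν ≤
      ∫⁻ ω, (a * (φ (μ.rnDeriv ν ω).toReal).toENNReal
        + b * (φ (μ'.rnDeriv ν ω).toReal).toENNReal) ∂ν := by
    refine lintegral_mono_ae ?_
    filter_upwards [Measure.rnDeriv_add (a • μ) (b • μ') ν, Measure.rnDeriv_smul_left μ ν a,
      Measure.rnDeriv_smul_left μ' ν b, Measure.rnDeriv_lt_top μ ν, Measure.rnDeriv_lt_top μ' ν]
      with ω h h' h'' hlt hlt'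
    rw [h, Pi.add_apply, h', h'', Pi.smul_apply, Pi.smul_apply, ENNReal.smul_def, ENNReal.smul_def,
      smul_eq_mul, smul_eq_mul, ENNReal.toReal_add (ENNReal.mul_ne_top (by simp) hlt.ne)
        (ENNReal.mul_ne_top (by simp) hlt'.ne), ENNReal.toReal_mul, ENNReal.toReal_mul]
    exact hφ.toENNReal_combo_le _ _ ha hb hab
  have hm : ∀ ξ : Measure Ω, Measurable fun ω => (φ (ξ.rnDeriv ν ω).toReal).toENNReal := fun ξ =>
    hφ.measurable_toENNReal.comp (Measure.measurable_rnDeriv ξ ν).ennreal_toReal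
  rw [lintegral_add_left ((hm μ).const_mul _), lintegral_const_mul _ (hm μ),
    lintegral_const_mul _ (hm μ')] at h1
  unfold divergence
  rw [Measure.singularPart_add, Measure.singularPart_smul, Measure.singularPart_smul]
  refine (add_le_add_left h1 _).trans (le_of_eq ?_)
  simp only [Measure.add_apply, Measure.smul_apply, ENNReal.smul_def, smul_eq_mul]
  ring

theorem divergence_self [IsProbabilityMeasure ν] : divergence φ ν ν = 0 := by
  simpa [hφ.one] using divergence_smul_self φ ν 1

/-- Mass added to `ν` costs at most the slope at infinity per unit: by `toENNReal_one_add_le` for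
its absolutely continuous part, and by definition for its singular part. -/
theorem divergence_self_add_le [IsFiniteMeasure μ] [IsProbabilityMeasure ν] :
    divergence φ (ν + μ) ν ≤ μ univ * (slopeAtTop φ).toENNReal := by
  have h1 : ∫⁻ ω, (φ ((ν + μ).rnDeriv ν ω).toReal).toENNReal ∂ν ≤
      ∫⁻ ω, μ.rnDeriv ν ω * (slopeAtTop φ).toENNReal ∂ν := by
    refine lintegral_mono_ae ?_
    filter_upwards [Measure.rnDeriv_add ν μ ν, Measure.rnDeriv_self ν, Measure.rnDeriv_lt_top μ ν]
      with ω h h' hlt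
    rw [h, Pi.add_apply, h', ENNReal.toReal_add (by simp) hlt.ne, ENNReal.toReal_one]
    refine (hφ.toENNReal_one_add_le ENNReal.toReal_nonneg).trans (le_of_eq ?_)
    rw [ENNReal.ofReal_toReal hlt.ne]
  rw [lintegral_mul_const _ (Measure.measurable_rnDeriv μ ν)] at h1
  unfold divergence
  rw [Measure.singularPart_add, Measure.singularPart_self, zero_add]
  refine (add_le_add_left h1 _).trans (le_of_eq ?_)
  rw [← add_mul]
  congr 1
  conv_rhs => rw [← Measure.rnDeriv_add_singularPart μ ν]
  simp

end Divergence

/-! ### The shifted conjugate and weak duality -/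

/-- The conjugate of the translate `x ↦ φ (x + 1)`. -/
noncomputable def shiftConj (φ : ℝ → EReal) (y : ℝ) : EReal := convexConj (fun x => φ (x + 1)) y

theorem le_shiftConj {φ : ℝ → EReal} {x a : ℝ} (h : φ x ≤ (a : EReal)) (y : ℝ) :
    (((x - 1) * y - a : ℝ) : EReal) ≤ shiftConj φ y :=
  le_convexConj (f := fun x => φ (x + 1)) (x := x - 1) (by simpa using h) y

theorem shiftConj_le_iff {φ : ℝ → EReal} {y : ℝ} {c : EReal} :
    shiftConj φ y ≤ c ↔
      ∀ x a : ℝ, φ x ≤ (a : EReal) → (((x - 1) * y - a : ℝ) : EReal) ≤ c := by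
  rw [shiftConj, convexConj_le_iff]
  constructor
  · intro h x a ha
    exact h (x - 1) a (by simpa using ha)
  · intro h x a ha
    simpa using h (x + 1) a ha

theorem shiftConj_nonneg {φ : ℝ → EReal} (hφ : IsDivergenceFunction φ) (y : ℝ) :
    0 ≤ shiftConj φ y := by
  simpa using le_shiftConj (φ := φ) (x := 1) (a := 0) (by simp [hφ.one]) y

theorem measurable_shiftConj (φ : ℝ → EReal) : Measurable (shiftConj φ) :=
  (lowerSemicontinuous_convexConj _).measurable

theorem convexConj_eq_shiftConj_add (φ : ℝ → EReal) (y : ℝ) :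
    convexConj φ y = shiftConj φ y + (y : EReal) := by
  refine le_antisymm ?_ ?_
  · rw [convexConj_le_iff]
    intro x a ha
    have := add_le_add_left (le_shiftConj ha y) (y : EReal)
    refine le_trans (le_of_eq ?_) this
    norm_cast
    ring
  · rw [← EReal.le_sub_iff_add_le (by simp) (by simp), shiftConj_le_iff]
    intro x a ha
    rw [EReal.le_sub_iff_add_le (by simp) (by simp)]
    refine le_trans (le_of_eq ?_) (le_convexConj ha y)
    norm_cast
    ring

/-- Weak duality: the Fenchel-Young inequality at the density is integrated against `ν`, and the
bound on `h` is integrated against the singular part. -/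
theorem integral_sub_integral_le (φ : ℝ → EReal) (hφ : IsDivergenceFunction φ) (μ ν : Measure Ω)
    [IsFiniteMeasure μ] [IsProbabilityMeasure ν] {h : Ω → ℝ} (hhm : Measurable h)
    (hμ : Integrable h μ)
    (hν : Integrable h ν) (hle : ∀ᵐ ω ∂μ, (h ω : EReal) ≤ slopeAtTop φ) :
    ((∫ ω, h ω ∂μ - ∫ ω, h ω ∂ν : ℝ) : EReal) ≤
      ((∫⁻ ω, (shiftConj φ (h ω)).toENNReal ∂ν + divergence φ μ ν : ℝ≥0∞) : EReal) := by
  by_cases hI : ∫⁻ ω, (shiftConj φ (h ω)).toENNReal ∂ν = ⊤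
  · simp [hI]
  by_cases hD : divergence φ μ ν = ⊤
  · simp [hD]
  obtain ⟨hD1, hD2⟩ := ENNReal.add_ne_top.1 (show _ + _ ≠ _ from hD)
  set I := ∫⁻ ω, (shiftConj φ (h ω)).toENNReal ∂ν
  set D₁ := ∫⁻ ω, (φ (μ.rnDeriv ν ω).toReal).toENNReal ∂ν with hD₁
  set D₂ := μ.singularPart ν univ * (slopeAtTop φ).toENNReal with hD₂
  have hDeq : divergence φ μ ν = D₁ + D₂ := rfl
  have hmΦ : Measurable fun ω => (φ (μ.rnDeriv ν ω).toReal).toENNReal :=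
    hφ.measurable_toENNReal.comp (Measure.measurable_rnDeriv μ ν).ennreal_toReal
  have hmΨ : Measurable fun ω => (shiftConj φ (h ω)).toENNReal :=
    ((measurable_shiftConj φ).comp hhm).ereal_toENNReal
  have hac : ν.withDensity (μ.rnDeriv ν) ≤ μ := by
    conv_rhs => rw [← Measure.rnDeriv_add_singularPart μ ν]
    exact Measure.le_add_right le_rfl
  have hsing : μ.singularPart ν ≤ μ := Measure.singularPart_le μ ν
  have hi1 : Integrable (fun ω => (μ.rnDeriv ν ω).toReal * h ω) ν := by
    have := hμ.mono_measure hac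
    rwa [integrable_withDensity_iff_integrable_smul' (Measure.measurable_rnDeriv μ ν)
      (Measure.rnDeriv_lt_top μ ν)] at this
  have hint : ∫ ω, h ω ∂μ = ∫ ω, (μ.rnDeriv ν ω).toReal * h ω ∂ν + ∫ ω, h ω ∂μ.singularPart ν := by
    conv_lhs => rw [← Measure.rnDeriv_add_singularPart μ ν]
    rw [integral_add_measure (hμ.mono_measure hac) (hμ.mono_measure hsing),
      integral_withDensity_eq_integral_toReal_smul (Measure.measurable_rnDeriv μ ν)
      (Measure.rnDeriv_lt_top μ ν)]
    simp
  have hA : ∫ ω, (μ.rnDeriv ν ω).toReal * h ω ∂ν - ∫ ω, h ω ∂ν ≤ D₁.toReal + I.toReal := by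
    rw [← integral_sub hi1 hν, hD₁, ← integral_toReal hmΦ.aemeasurable
      (ae_lt_top hmΦ hD1), ← integral_toReal hmΨ.aemeasurable (ae_lt_top hmΨ hI),
      ← integral_add (integrable_toReal_of_lintegral_ne_top hmΦ.aemeasurable hD1)
        (integrable_toReal_of_lintegral_ne_top hmΨ.aemeasurable hI)]
    refine integral_mono_ae (hi1.sub hν)
      ((integrable_toReal_of_lintegral_ne_top hmΦ.aemeasurable hD1).add
        (integrable_toReal_of_lintegral_ne_top hmΨ.aemeasurable hI)) ?_
    filter_upwards [ae_lt_top hmΦ hD1, ae_lt_top hmΨ hI] with ω h1 h2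
    have h1' := EReal.toENNReal_ne_top_iff.1 h1.ne
    have h2' := EReal.toENNReal_ne_top_iff.1 h2.ne
    obtain ⟨u, hu0, hu⟩ := EReal.exists_coe_of_nonneg_of_lt_top
      (hφ.nonneg (μ.rnDeriv ν ω).toReal) (lt_top_iff_ne_top.2 h1')
    obtain ⟨w, hw0, hw⟩ := EReal.exists_coe_of_nonneg_of_lt_top (shiftConj_nonneg hφ (h ω))
      (lt_top_iff_ne_top.2 h2')
    have h3 := le_shiftConj hu.le (h ω)
    rw [hw] at h3
    have h4 : ((μ.rnDeriv ν ω).toReal - 1) * h ω - u ≤ w := by exact_mod_cast h3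
    simp only [hu, hw, EReal.real_coe_toENNReal, ENNReal.toReal_ofReal hu0,
      ENNReal.toReal_ofReal hw0]
    linarith
  have hB : ∫ ω, h ω ∂μ.singularPart ν ≤ D₂.toReal := by
    by_cases hz : μ.singularPart ν = 0
    · simp [hz]
    -- A nonzero singular part with finite divergence forces a finite slope.
    have hκ : slopeAtTop φ ≠ ⊤ := by
      rintro htop
      rw [hD₂, htop, EReal.toENNReal_top, ENNReal.mul_top (by simpa using hz)] at hD2
      exact hD2 rfl
    obtain ⟨κ, hκ0, hκ⟩ := EReal.exists_coe_of_nonneg_of_lt_top hφ.slopeAtTop_nonneg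
      (lt_top_iff_ne_top.2 hκ)
    rw [hD₂, hκ, EReal.real_coe_toENNReal, ENNReal.toReal_mul, ENNReal.toReal_ofReal hκ0]
    have : ∫ ω, h ω ∂μ.singularPart ν ≤ ∫ _, κ ∂μ.singularPart ν := by
      refine integral_mono_ae (hμ.mono_measure hsing) (integrable_const κ) ?_
      have := ae_mono hsing hle
      filter_upwards [this] with ω hω
      rw [hκ] at hω
      exact_mod_cast hω
    simpa [Measure.real] using this
  rw [hDeq, ← EReal.coe_ennreal_toReal (ENNReal.add_ne_top.2 ⟨hI, ENNReal.add_ne_top.2 ⟨hD1, hD2⟩⟩),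
    ENNReal.toReal_add hI (ENNReal.add_ne_top.2 ⟨hD1, hD2⟩), ENNReal.toReal_add hD1 hD2]
  norm_cast
  linarith

/-- Since `u ≥ 0` and `y` is integrable, the negative part of the sum has finite integral, so `∞ -
∞` cannot occur. -/
theorem extIntegral_add_coe {ν : Measure Ω} {u : Ω → EReal} (hu : Measurable u)
    (h0 : ∀ ω, 0 ≤ u ω) {y : Ω → ℝ} (hy : Measurable y) (hyi : Integrable y ν) :
    extIntegral ν (fun ω => u ω + (y ω : EReal)) = extIntegral ν u + ((∫ ω, y ω ∂ν : ℝ) : EReal) := by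
  -- The decomposition into positive and negative parts, rearranged without subtraction so that it
  -- can be integrated in `[0, ∞]`.
  have hpt : ∀ ω, (u ω + (y ω : EReal)).toENNReal + ENNReal.ofReal (-y ω)
      = (u ω).toENNReal + ENNReal.ofReal (y ω) + (-(u ω + (y ω : EReal))).toENNReal := by
    intro ω
    by_cases htop : u ω = ⊤
    · simp [htop]
    obtain ⟨a, ha0, ha⟩ := EReal.exists_coe_of_nonneg_of_lt_top (h0 ω) (lt_top_iff_ne_top.2 htop)
    rw [ha, ← EReal.coe_add, ← EReal.coe_neg]
    simp only [EReal.real_coe_toENNReal]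
    rw [← ENNReal.toReal_eq_toReal_iff' (by finiteness) (by finiteness)]
    rw [ENNReal.toReal_add (by simp) (by simp), ENNReal.toReal_add (by simp) (by simp),
      ENNReal.toReal_add (by simp) (by simp)]
    simp only [ENNReal.toReal_ofReal']
    rw [max_eq_left ha0]
    have h1 := max_zero_sub_max_neg_zero_eq_self (a + y ω)
    have h2 := max_zero_sub_max_neg_zero_eq_self (y ω)
    linarith
  have hPN : Measurable fun ω => (u ω + (y ω : EReal)) := hu.add hy.coe_real_ereal
  set P := ∫⁻ ω, (u ω + (y ω : EReal)).toENNReal ∂ν with hP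
  set N := ∫⁻ ω, (-(u ω + (y ω : EReal))).toENNReal ∂ν with hN
  have hsum : P + ∫⁻ ω, ENNReal.ofReal (-y ω) ∂ν
      = ∫⁻ ω, (u ω).toENNReal ∂ν + ∫⁻ ω, ENNReal.ofReal (y ω) ∂ν + N := by
    rw [hP, hN, ← lintegral_add_left hPN.ereal_toENNReal, ← lintegral_add_left (f := fun ω => (u ω).toENNReal) hu.ereal_toENNReal,
      ← lintegral_add_left (f := fun ω => (u ω).toENNReal + ENNReal.ofReal (y ω))
        (hu.ereal_toENNReal.add hy.ennreal_ofReal)]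
    exact lintegral_congr hpt
  have hyn : ∫⁻ ω, ENNReal.ofReal (-y ω) ∂ν ≠ ⊤ := hyi.neg.lintegral_lt_top.ne
  have hyp : ∫⁻ ω, ENNReal.ofReal (y ω) ∂ν ≠ ⊤ := hyi.lintegral_lt_top.ne
  have hNtop : N ≠ ⊤ := by
    refine ne_top_of_le_ne_top hyn (lintegral_mono fun ω => ?_)
    rw [← EReal.real_coe_toENNReal]
    refine EReal.toENNReal_le_toENNReal ?_
    rw [EReal.coe_neg, EReal.neg_le_neg_iff]
    exact le_add_of_nonneg_left (h0 ω)
  rw [extIntegral_of_nonneg ν h0, extIntegral, ← hP, ← hN,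
    integral_eq_lintegral_pos_part_sub_lintegral_neg_part hyi]
  set a := ∫⁻ ω, ENNReal.ofReal (-y ω) ∂ν
  set b := ∫⁻ ω, ENNReal.ofReal (y ω) ∂ν
  set J := ∫⁻ ω, (u ω).toENNReal ∂ν
  by_cases hJ : J = ⊤
  · have hPt : P = ⊤ := by
      rw [hJ] at hsum
      by_contra hne
      exact ENNReal.add_ne_top.2 ⟨hne, hyn⟩ (by rw [hsum]; simp)
    rw [hJ, hPt, ← EReal.coe_ennreal_toReal hNtop, EReal.coe_ennreal_top, EReal.top_sub_coe,
      EReal.top_add_coe]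
  · have hPt : P ≠ ⊤ := by
      intro hPt
      rw [hPt, top_add] at hsum
      exact ENNReal.add_ne_top.2 ⟨ENNReal.add_ne_top.2 ⟨hJ, hyp⟩, hNtop⟩ hsum.symm
    rw [← EReal.coe_ennreal_toReal hNtop, ← EReal.coe_ennreal_toReal hPt,
      ← EReal.coe_ennreal_toReal hJ]
    have := congrArg ENNReal.toReal hsum
    rw [ENNReal.toReal_add hPt hyn, ENNReal.toReal_add (ENNReal.add_ne_top.2 ⟨hJ, hyp⟩) hNtop,
      ENNReal.toReal_add hJ hyp] at this
    norm_cast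
    linarith

/-! ### Pointwise approximate maximizers -/

/-- The expression `(x - 1) y - φ x` whose supremum over `x` is the shifted conjugate at `y`. -/
noncomputable def conjScore (φ : ℝ → EReal) (x y : ℝ) : ℝ := (x - 1) * y - (φ x).toReal

open Classical in
/-- A sequence that runs through the rational points of the effective domain of `φ`. -/
noncomputable def domSeq (φ : ℝ → EReal) (n : ℕ) : ℝ :=
  if φ (Denumerable.ofNat ℚ n : ℚ) < ⊤ then (Denumerable.ofNat ℚ n : ℚ) else 1

open Classical in
/-- A maximizer of `conjScore φ · y` among `1` and the first `n` terms of `domSeq φ`. -/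
noncomputable def scoreMaximizer (φ : ℝ → EReal) : ℕ → ℝ → ℝ
  | 0, _ => 1
  | n + 1, y =>
    if conjScore φ (scoreMaximizer φ n y) y < conjScore φ (domSeq φ n) y then domSeq φ n
    else scoreMaximizer φ n y

section Maximizer

variable {φ : ℝ → EReal}

/-- Finitely many values make both the density built from `scoreMaximizer` and its composite with
`φ` bounded, even if `φ` is unbounded on its domain. -/
theorem finite_range_scoreMaximizer (φ : ℝ → EReal) (n : ℕ) :
    (range (scoreMaximizer φ n)).Finite := by
  induction n with
  | zero => exact (finite_singleton 1).subset (by rintro _ ⟨y, rfl⟩; simp [scoreMaximizer])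
  | succ n ih =>
    refine (ih.insert (domSeq φ n)).subset ?_
    rintro _ ⟨y, rfl⟩
    rw [scoreMaximizer]
    split_ifs
    · exact mem_insert _ _
    · exact mem_insert_of_mem _ ⟨y, rfl⟩

theorem exists_le_scoreMaximizer (φ : ℝ → EReal) (F : ℝ → ℝ) (n : ℕ) :
    ∃ B, ∀ y, F (scoreMaximizer φ n y) ≤ B := by
  obtain ⟨B, hB⟩ := ((finite_range_scoreMaximizer φ n).image F).bddAbove
  exact ⟨B, fun y => hB ⟨_, ⟨y, rfl⟩, rfl⟩⟩

theorem conjScore_mono (φ : ℝ → EReal) (y : ℝ) :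
    Monotone fun n => conjScore φ (scoreMaximizer φ n y) y := by
  refine monotone_nat_of_le_succ fun n => ?_
  rw [scoreMaximizer]
  split_ifs with h
  · exact h.le
  · exact le_rfl

theorem conjScore_domSeq_le (φ : ℝ → EReal) (n : ℕ) (y : ℝ) :
    conjScore φ (domSeq φ n) y ≤ conjScore φ (scoreMaximizer φ (n + 1) y) y := by
  rw [scoreMaximizer]
  split_ifs with h
  · exact le_rfl
  · exact not_lt.1 h

variable (hφ : IsDivergenceFunction φ)

include hφ

theorem domSeq_lt_top (n : ℕ) : φ (domSeq φ n) < ⊤ := by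
  unfold domSeq
  split_ifs with h
  · exact h
  · simp [hφ.one]

theorem scoreMaximizer_lt_top (n : ℕ) (y : ℝ) : φ (scoreMaximizer φ n y) < ⊤ := by
  induction n with
  | zero => simp [scoreMaximizer, hφ.one]
  | succ n ih =>
    rw [scoreMaximizer]
    split_ifs
    · exact domSeq_lt_top hφ n
    · exact ih

theorem scoreMaximizer_nonneg (n : ℕ) (y : ℝ) : 0 ≤ scoreMaximizer φ n y := by
  by_contra h
  exact (scoreMaximizer_lt_top hφ n y).ne (hφ.neg_eq_top _ (not_le.1 h))

theorem conjScore_scoreMaximizer_nonneg (n : ℕ) (y : ℝ) :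
    0 ≤ conjScore φ (scoreMaximizer φ n y) y := by
  refine le_trans (le_of_eq ?_) (conjScore_mono φ y (Nat.zero_le n))
  simp [scoreMaximizer, conjScore, hφ.one]

theorem measurable_scoreMaximizer (n : ℕ) : Measurable (scoreMaximizer φ n) := by
  induction n with
  | zero => exact measurable_const
  | succ n ih =>
    have hm : Measurable fun x => (φ x).toReal := hφ.lsc.measurable.ereal_toReal
    refine Measurable.ite (measurableSet_lt ?_ ?_) measurable_const ih
    · exact ((ih.sub_const 1).mul measurable_id).sub (hm.comp ih)
    · exact (measurable_id.const_mul _).sub_const _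

/-- Rational points suffice. If `φ x ≤ a`, then convexity and `φ 1 = 0 ≤ a` give `φ ≤ a` on the open
segment from `x` to `1`. The bound thus holds at its rational points with `a` fixed, and is
continuous in the point, so it extends to the endpoint `x` without continuity of `φ`. -/
theorem shiftConj_le_iSup (y : ℝ) :
    shiftConj φ y ≤ ⨆ n, ((conjScore φ (scoreMaximizer φ n y) y : ℝ) : EReal) := by
  set S := ⨆ n, ((conjScore φ (scoreMaximizer φ n y) y : ℝ) : EReal)
  have hS : ∀ n, ((conjScore φ (scoreMaximizer φ n y) y : ℝ) : EReal) ≤ S := fun n =>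
    le_iSup (fun n => ((conjScore φ (scoreMaximizer φ n y) y : ℝ) : EReal)) n
  rw [shiftConj_le_iff]
  intro x a hxa
  have ha : 0 ≤ a := by exact_mod_cast (hφ.nonneg x).trans hxa
  have hrat : ∀ p ∈ Ioo (min x 1) (max x 1) ∩ range ((↑) : ℚ → ℝ),
      (((p - 1) * y - a : ℝ) : EReal) ≤ S := by
    rintro _ ⟨hp, p, rfl⟩
    have hpa : φ p ≤ (a : EReal) := by
      have hseg : (p : ℝ) ∈ openSegment ℝ x 1 := by
        rcases lt_trichotomy x 1 with h | h | h
        · rw [openSegment_eq_Ioo h]; simpa [h.le] using hp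
        · simp [h] at hp
        · rw [openSegment_symm, openSegment_eq_Ioo h]; simpa [h.le] using hp
      obtain ⟨α, β, hα, hβ, hαβ, hpe⟩ := hseg
      have := hφ.convex.le_combo hxa (y := 1) (w := 0) (by simp [hφ.one]) hα.le hβ.le hαβ
      simp only [smul_eq_mul] at hpe
      rw [hpe] at this
      refine this.trans ?_
      norm_cast
      nlinarith
    obtain ⟨n, hn⟩ : ∃ n, Denumerable.ofNat ℚ n = p := ⟨_, Denumerable.ofNat_encode p⟩
    have hdom : domSeq φ n = p := by
      unfold domSeq
      rw [hn, if_pos (hpa.trans_lt (EReal.coe_lt_top a))]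
    refine le_trans ?_ (hS (n + 1))
    have h2 := conjScore_domSeq_le φ n y
    rw [hdom] at h2
    refine le_trans ?_ (EReal.coe_le_coe_iff.2 h2)
    have h3 : (φ p).toReal ≤ a := by
      obtain ⟨u, -, hu⟩ := EReal.exists_coe_of_nonneg_of_lt_top (hφ.nonneg p)
        (hpa.trans_lt (EReal.coe_lt_top a))
      rw [hu] at hpa ⊢
      simpa using hpa
    rw [EReal.coe_le_coe_iff]
    unfold conjScore
    linarith
  rcases eq_or_ne x 1 with rfl | hx
  · refine le_trans ?_ (hS 0)
    norm_cast
    simp [scoreMaximizer, conjScore, hφ.one, ha]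
  · have hclosed : IsClosed {p : ℝ | (((p - 1) * y - a : ℝ) : EReal) ≤ S} := by
      refine isClosed_le ?_ continuous_const
      have h : Continuous fun p : ℝ => (p - 1) * y - a := by fun_prop
      exact continuous_coe_real_ereal.comp h
    have h1 : Ioo (min x 1) (max x 1) ⊆ {p : ℝ | (((p - 1) * y - a : ℝ) : EReal) ≤ S} :=
      (Rat.denseRange_cast.open_subset_closure_inter isOpen_Ioo).trans
        (closure_minimal hrat hclosed)
    have h2 := closure_minimal h1 hclosed
    rw [closure_Ioo (min_lt_max.2 hx).ne] at h2
    exact h2 ⟨min_le_left _ _, le_max_left _ _⟩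

end Maximizer

/-! ### Cones of measures -/

/-- What the duality argument needs of a cone `C` of finite measures, a `σ`-ideal `Ξ`, a function
`f` and a measure `ν`. -/
structure IsAdmissibleCone (C : Set (Measure Ω)) (Ξ : Set (Set Ω)) (f : Ω → ℝ) (ν : Measure Ω) :
    Prop where
  finite : ∀ μ ∈ C, IsFiniteMeasure μ
  add_mem : ∀ μ ∈ C, ∀ μ' ∈ C, μ + μ' ∈ C
  smul_mem : ∀ c : ℝ≥0, ∀ μ ∈ C, c • μ ∈ C
  self_mem : ν ∈ C
  withDensity_mem : ∀ r : Ω → ℝ, Measurable r → (∀ ω, 0 ≤ r ω) → (∃ B, ∀ ω, r ω ≤ B) →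
    ν.withDensity (fun ω => ENNReal.ofReal (r ω)) ∈ C
  null : ∀ A ∈ Ξ, ∀ μ ∈ C, μ A = 0
  exists_concentrated : ∀ A, MeasurableSet A → A ∉ Ξ → ∃ μ ∈ C, μ ≠ 0 ∧ μ Aᶜ = 0
  measurable : Measurable f
  integrable : ∀ μ ∈ C, Integrable f μ

namespace IsAdmissibleCone

variable {C : Set (Measure Ω)} {Ξ : Set (Set Ω)} {f : Ω → ℝ} {ν : Measure Ω}

theorem const_mul (hC : IsAdmissibleCone C Ξ f ν) (t : ℝ) :
    IsAdmissibleCone C Ξ (fun ω => t * f ω) ν :=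
  { hC with
    measurable := hC.measurable.const_mul t
    integrable := fun μ hμ => (hC.integrable μ hμ).const_mul t }

/-- Each point off the essential range has a neighbourhood that is null for the image measure; on
the line, locally null sets are null. -/
theorem ae_mem_essRange (hC : IsAdmissibleCone C Ξ f ν) {μ : Measure Ω} (hμ : μ ∈ C) :
    ∀ᵐ ω ∂μ, f ω ∈ essRange Ξ f := by
  have : (μ.map f) (essRange Ξ f)ᶜ = 0 := by
    refine measure_null_of_locally_null _ fun x hx => ?_
    simp only [essRange, mem_compl_iff, mem_ofPred_eq, not_forall, not_not] at hx
    obtain ⟨δ, hδ, hmem⟩ := hx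
    refine ⟨Ioo (x - δ) (x + δ), mem_nhdsWithin_of_mem_nhds
      (Ioo_mem_nhds (by linarith) (by linarith)), ?_⟩
    rw [Measure.map_apply hC.measurable measurableSet_Ioo]
    exact hC.null _ hmem μ hμ
  exact ae_of_ae_map hC.measurable.aemeasurable (measure_eq_zero_iff_ae_notMem.1 this |>.mono
    fun x hx => not_not.1 hx)

theorem ae_le_slopeAtTop (hC : IsAdmissibleCone C Ξ f ν) {φ : ℝ → EReal} {l : ℝ}
    (hl : (l : EReal) + essSupIdeal Ξ f ≤ slopeAtTop φ) {μ : Measure Ω} (hμ : μ ∈ C) :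
    ∀ᵐ ω ∂μ, ((f ω + l : ℝ) : EReal) ≤ slopeAtTop φ := by
  filter_upwards [hC.ae_mem_essRange hμ] with ω hω
  refine le_trans ?_ hl
  rw [EReal.coe_add, add_comm]
  exact add_le_add_right (le_sSup (mem_image_of_mem _ hω)) _

variable [IsProbabilityMeasure ν] {φ : ℝ → EReal} (hφ : IsDivergenceFunction φ)

include hφ

/-- `l` is the Lagrange multiplier of the constraint of total mass 1: the slope at abscissa 1 of a
line below the convex set of pairs (mass, upper bound of the penalized cost). The conclusion holds
for measures of any mass, which frees the choice of test measures. -/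
theorem exists_multiplier (hC : IsAdmissibleCone C Ξ f ν) {w : ℝ}
    (hw : ∀ μ ∈ C, μ.real univ = 1 → divergence φ μ ν ≠ ⊤ →
      ∫ ω, f ω ∂μ - (divergence φ μ ν).toReal ≤ w) :
    ∃ l : ℝ, ∀ μ ∈ C, divergence φ μ ν ≠ ⊤ →
      ∫ ω, f ω ∂μ + l * μ.real univ - (divergence φ μ ν).toReal ≤ w + l := by
  set E : Set (ℝ × ℝ) := {p | ∃ μ ∈ C, divergence φ μ ν ≠ ⊤ ∧ μ.real univ = p.1 ∧
    (divergence φ μ ν).toReal - ∫ ω, f ω ∂μ ≤ p.2} with hE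
  have hconv : Convex ℝ E := by
    rw [convex_iff_forall_pos]
    rintro p ⟨μ, hμ, hD, hp1, hp2⟩ q ⟨μ', hμ', hD', hq1, hq2⟩ a b ha hb hab
    lift a to ℝ≥0 using ha.le
    lift b to ℝ≥0 using hb.le
    have := hC.finite μ hμ
    have := hC.finite μ' hμ'
    have ha0 : a ≠ 0 := by rintro rfl; simp at ha
    have hb0 : b ≠ 0 := by rintro rfl; simp at hb
    have hle := divergence_combo_le hφ μ μ' ν ha0 hb0 (by exact_mod_cast hab)
    have hfin : (a : ℝ≥0∞) * divergence φ μ ν + b * divergence φ μ' ν ≠ ⊤ := by finiteness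
    refine ⟨a • μ + b • μ', hC.add_mem _ (hC.smul_mem _ _ hμ) _ (hC.smul_mem _ _ hμ'),
      ne_top_of_le_ne_top hfin hle, ?_, ?_⟩
    · rw [measureReal_add_apply, measureReal_nnreal_smul_apply, measureReal_nnreal_smul_apply,
        hp1, hq1]
      simp
    · have h1 := ENNReal.toReal_mono hfin hle
      rw [ENNReal.toReal_add (by finiteness) (by finiteness), ENNReal.toReal_mul,
        ENNReal.toReal_mul, ENNReal.coe_toReal, ENNReal.coe_toReal] at h1
      rw [integral_add_measure ((hC.integrable _ (hC.smul_mem _ _ hμ)))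
        ((hC.integrable _ (hC.smul_mem _ _ hμ'))), integral_smul_nnreal_measure,
        integral_smul_nnreal_measure]
      simp only [NNReal.smul_def, smul_eq_mul, Prod.snd_add, Prod.smul_snd]
      have h2 := mul_le_mul_of_nonneg_left hp2 ha.le
      have h3 := mul_le_mul_of_nonneg_left hq2 hb.le
      linarith
  have hpt : ∀ c : ℝ, 0 ≤ c → φ c < ⊤ → ∃ p ∈ E, p.1 = c := fun c hc0 hc => by
    lift c to ℝ≥0 using hc0
    refine ⟨(c, _), ⟨c • ν, hC.smul_mem _ _ hC.self_mem, ?_, ?_, le_rfl⟩, rfl⟩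
    · rw [divergence_smul_self]
      exact EReal.toENNReal_ne_top_iff.2 hc.ne
    · rw [measureReal_nnreal_smul_apply]; simp
  obtain ⟨δ, hδ, hball⟩ := Metric.eventually_nhds_iff_ball.1 hφ.finite_near_one
  -- Truncating at 1 keeps both factors `1 ± min δ 1 / 2` nonnegative, so that they scale `ν` within
  -- the cone.
  have hm : 0 < min δ 1 := lt_min hδ one_pos
  have hmδ : min δ 1 ≤ δ := min_le_left _ _
  have hm1 : min δ 1 ≤ 1 := min_le_right _ _
  obtain ⟨p, hp, hp1⟩ := hpt (1 - min δ 1 / 2) (by linarith)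
    (hball _ (by rw [Metric.mem_ball, Real.dist_eq, sub_sub_cancel_left, abs_neg,
      abs_of_pos] <;> linarith))
  obtain ⟨q, hq, hq1⟩ := hpt (1 + min δ 1 / 2) (by linarith)
    (hball _ (by rw [Metric.mem_ball, Real.dist_eq, add_sub_cancel_left,
      abs_of_pos] <;> linarith))
  obtain ⟨l, hl⟩ := exists_supporting_line hconv (x₀ := 1) (v := -w)
    (by
      rintro y ⟨μ, hμ, hD, h1, h2⟩
      have := hw μ hμ h1 hD
      simp only at h2
      linarith)
    ⟨p, hp, by linarith⟩ ⟨q, hq, by linarith⟩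
  refine ⟨l, fun μ hμ hD => ?_⟩
  have := hl (μ.real univ, (divergence φ μ ν).toReal - ∫ ω, f ω ∂μ) ⟨μ, hμ, hD, rfl, le_rfl⟩
  simp only at this
  linarith

/-- Take `μ` concentrated where `f` is within `δ` of an essential value `x`, and test with `ν + n
μ`. The gain is linear in `n` and bounded, so its coefficient is nonpositive, which gives `x - δ + l
≤ κ`. -/
theorem add_essSupIdeal_le (hC : IsAdmissibleCone C Ξ f ν) {w l : ℝ}
    (hl : ∀ μ ∈ C, divergence φ μ ν ≠ ⊤ →
      ∫ ω, f ω ∂μ + l * μ.real univ - (divergence φ μ ν).toReal ≤ w + l) :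
    (l : EReal) + essSupIdeal Ξ f ≤ slopeAtTop φ := by
  by_cases htop : slopeAtTop φ = ⊤
  · simp [htop]
  obtain ⟨κ, hκ0, hκ⟩ := EReal.exists_coe_of_nonneg_of_lt_top hφ.slopeAtTop_nonneg
    (lt_top_iff_ne_top.2 htop)
  rw [hκ, add_comm, ← EReal.le_sub_iff_add_le (by simp) (by simp)]
  refine sSup_le ?_
  rintro _ ⟨x, hx, rfl⟩
  change (x : EReal) ≤ (κ : EReal) - (l : EReal)
  rw [← EReal.coe_sub, EReal.coe_le_coe_iff]
  refine le_of_forall_pos_le_add fun δ hδ => ?_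
  obtain ⟨μ, hμ, hμ0, hμA⟩ := hC.exists_concentrated _
    (hC.measurable measurableSet_Ioo) (hx δ hδ)
  have := hC.finite μ hμ
  have hm : 0 < μ.real univ := by simpa [measureReal_def, ENNReal.toReal_pos_iff] using hμ0
  have hμf : (x - δ) * μ.real univ ≤ ∫ ω, f ω ∂μ := by
    have : ∫ _, (x - δ) ∂μ ≤ ∫ ω, f ω ∂μ := by
      refine integral_mono_ae (integrable_const _) (hC.integrable μ hμ) ?_
      filter_upwards [measure_eq_zero_iff_ae_notMem.1 hμA] with ω hω
      exact (not_not.1 hω).1.le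
    simpa [mul_comm] using this
  have hn : ∀ n : ℕ, n * (∫ ω, f ω ∂μ + l * μ.real univ - κ * μ.real univ)
      ≤ w - ∫ ω, f ω ∂ν := by
    intro n
    have hmem := hC.smul_mem n μ hμ
    have hD := divergence_self_add_le hφ ((n : ℝ≥0) • μ) ν
    rw [hκ, EReal.real_coe_toENNReal] at hD
    have hDtop : ((n : ℝ≥0) • μ) univ * ENNReal.ofReal κ ≠ ⊤ := by finiteness
    have h1 := hl (ν + (n : ℝ≥0) • μ) (hC.add_mem _ hC.self_mem _ hmem)
      (ne_top_of_le_ne_top hDtop hD)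
    have h2 := ENNReal.toReal_mono hDtop hD
    rw [ENNReal.toReal_mul, ENNReal.toReal_ofReal hκ0, ← measureReal_def,
      measureReal_nnreal_smul_apply] at h2
    rw [integral_add_measure (hC.integrable _ hC.self_mem) (hC.integrable _ hmem),
      integral_smul_nnreal_measure, measureReal_add_apply, measureReal_nnreal_smul_apply] at h1
    simp only [NNReal.smul_def, smul_eq_mul, NNReal.coe_natCast, probReal_univ] at h1 h2
    linarith
  have hle : ∫ ω, f ω ∂μ + l * μ.real univ - κ * μ.real univ ≤ 0 := by
    by_contra hpos
    push Not at hpos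
    obtain ⟨n, hn'⟩ := exists_nat_gt ((w - ∫ ω, f ω ∂ν)
      / (∫ ω, f ω ∂μ + l * μ.real univ - κ * μ.real univ))
    rw [div_lt_iff₀ hpos] at hn'
    exact absurd (hn n) (not_le.2 hn')
  have : (x - δ + l - κ) * μ.real univ ≤ 0 := by linarith
  have := nonpos_of_mul_nonpos_left this hm
  linarith

/-- The multiplier inequality, tested with the density `scoreMaximizer φ n (f + l)`, bounds the
integral of the `n`-th score uniformly in `n`. The scores increase to at least the shifted
conjugate, and monotone convergence concludes. -/
theorem lintegral_shiftConj_le (hC : IsAdmissibleCone C Ξ f ν) {w l : ℝ}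
    (hl : ∀ μ ∈ C, divergence φ μ ν ≠ ⊤ →
      ∫ ω, f ω ∂μ + l * μ.real univ - (divergence φ μ ν).toReal ≤ w + l) :
    ∫⁻ ω, (shiftConj φ (f ω + l)).toENNReal ∂ν ≤ ENNReal.ofReal (w - ∫ ω, f ω ∂ν) := by
  set h : Ω → ℝ := fun ω => f ω + l with hh
  have hhm : Measurable h := hC.measurable.add_const l
  have hfν := hC.integrable ν hC.self_mem
  have hhν : Integrable h ν := hfν.add (integrable_const l)
  have hmR : Measurable fun x => (φ x).toReal := hφ.lsc.measurable.ereal_toReal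
  have hms : ∀ n, Measurable fun ω => conjScore φ (scoreMaximizer φ n (h ω)) (h ω) := fun n => by
    have h1 := (measurable_scoreMaximizer hφ n).comp hhm
    exact ((h1.sub_const 1).mul hhm).sub (hmR.comp h1)
  calc ∫⁻ ω, (shiftConj φ (h ω)).toENNReal ∂ν
      ≤ ∫⁻ ω, ⨆ n, ENNReal.ofReal (conjScore φ (scoreMaximizer φ n (h ω)) (h ω)) ∂ν := by
        refine lintegral_mono fun ω => ?_
        have h1 : shiftConj φ (h ω) ≤
            ((⨆ n, ENNReal.ofReal (conjScore φ (scoreMaximizer φ n (h ω)) (h ω)) : ℝ≥0∞) :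
              EReal) := by
          refine (shiftConj_le_iSup hφ (h ω)).trans (iSup_le fun n => ?_)
          refine le_trans ?_ (EReal.coe_ennreal_le_coe_ennreal_iff.2
            (le_iSup (fun n => ENNReal.ofReal (conjScore φ (scoreMaximizer φ n (h ω)) (h ω))) n))
          rw [EReal.coe_ennreal_ofReal]
          exact_mod_cast le_max_left _ _
        simpa using EReal.toENNReal_le_toENNReal h1
    _ = ⨆ n, ∫⁻ ω, ENNReal.ofReal (conjScore φ (scoreMaximizer φ n (h ω)) (h ω)) ∂ν := by
        refine lintegral_iSup (fun n => (hms n).ennreal_ofReal) fun n m hnm ω => ?_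
        exact ENNReal.ofReal_le_ofReal (conjScore_mono φ (h ω) hnm)
    _ ≤ ENNReal.ofReal (w - ∫ ω, f ω ∂ν) := by
        refine iSup_le fun n => ?_
        set r : Ω → ℝ := fun ω => scoreMaximizer φ n (h ω) with hr
        have hrm : Measurable r := (measurable_scoreMaximizer hφ n).comp hhm
        have hr0 : ∀ ω, 0 ≤ r ω := fun ω => scoreMaximizer_nonneg hφ n _
        obtain ⟨B, hB⟩ := exists_le_scoreMaximizer φ id n
        obtain ⟨B', hB'⟩ := exists_le_scoreMaximizer φ (fun x => (φ x).toReal) n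
        have hφ0 : ∀ ω, 0 ≤ (φ (r ω)).toReal := fun ω => EReal.toReal_nonneg (hφ.nonneg _)
        have hri : Integrable r ν := Integrable.of_bound hrm.aestronglyMeasurable B
          (ae_of_all _ fun ω => by rw [Real.norm_of_nonneg (hr0 ω)]; exact hB (h ω))
        have hφi : Integrable (fun ω => (φ (r ω)).toReal) ν :=
          Integrable.of_bound (hmR.comp hrm).aestronglyMeasurable B'
            (ae_of_all _ fun ω => by rw [Real.norm_of_nonneg (hφ0 ω)]; exact hB' (h ω))
        have hrf : Integrable (fun ω => r ω * f ω) ν :=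
          hfν.bdd_mul hrm.aestronglyMeasurable
            (ae_of_all _ fun ω => by rw [Real.norm_of_nonneg (hr0 ω)]; exact hB (h ω))
        set μ := ν.withDensity fun ω => ENNReal.ofReal (r ω) with hμ
        have hμC : μ ∈ C := hC.withDensity_mem r hrm hr0 ⟨B, fun ω => hB (h ω)⟩
        have hΦ : ∀ ω, (φ (r ω)).toENNReal = ENNReal.ofReal (φ (r ω)).toReal := fun ω =>
          EReal.toENNReal_of_ne_top (scoreMaximizer_lt_top hφ n (h ω)).ne
        have hD : divergence φ μ ν = ENNReal.ofReal (∫ ω, (φ (r ω)).toReal ∂ν) := by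
          rw [hμ, divergence_withDensity φ ν hrm hr0,
            ofReal_integral_eq_lintegral_ofReal hφi (ae_of_all _ hφ0)]
          exact lintegral_congr hΦ
        have hmass : μ.real univ = ∫ ω, r ω ∂ν := by
          rw [measureReal_def, hμ, withDensity_apply _ MeasurableSet.univ, setLIntegral_univ,
            ← ofReal_integral_eq_lintegral_ofReal hri (ae_of_all _ hr0),
            ENNReal.toReal_ofReal (integral_nonneg hr0)]
        have hfμ : ∫ ω, f ω ∂μ = ∫ ω, r ω * f ω ∂ν := by
          rw [hμ, integral_withDensity_eq_integral_toReal_smul hrm.ennreal_ofReal (by simp)]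
          simp [ENNReal.toReal_ofReal (hr0 _)]
        have key := hl μ hμC (by rw [hD]; simp)
        rw [hD, hmass, hfμ, ENNReal.toReal_ofReal (integral_nonneg hφ0)] at key
        have hscore : ∀ ω, conjScore φ (r ω) (h ω)
            = ((r ω * f ω + l * r ω) - (f ω + l)) - (φ (r ω)).toReal := fun ω => by
          simp only [conjScore, hh]; ring
        have hi1 : Integrable (fun ω => r ω * f ω + l * r ω) ν := hrf.add (hri.const_mul l)
        have hi2 : Integrable (fun ω => (r ω * f ω + l * r ω) - (f ω + l)) ν := hi1.sub hhν
        have hsi : Integrable (fun ω => conjScore φ (r ω) (h ω)) ν := by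
          simp_rw [hscore]; exact hi2.sub hφi
        rw [← ofReal_integral_eq_lintegral_ofReal hsi
          (ae_of_all _ fun ω => conjScore_scoreMaximizer_nonneg hφ n (h ω))]
        refine ENNReal.ofReal_le_ofReal ?_
        simp_rw [hscore]
        rw [integral_sub hi2 hφi, integral_sub hi1 hhν, integral_add hrf (hri.const_mul l),
          integral_const_mul, integral_add hfν (integrable_const l)]
        simp only [integral_const, probReal_univ, one_smul]
        linarith

/-- The duality between the penalized maximization over the probability measures in an admissible
cone and the minimization over admissible multipliers. -/
theorem iSup_sub_phiDivergence_eq (hC : IsAdmissibleCone C Ξ f ν) :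
    (⨆ (m : ProbabilityMeasure Ω) (_ : (m : Measure Ω) ∈ C),
      (((∫ ω, f ω ∂(m : Measure Ω) - ∫ ω, f ω ∂ν : ℝ) : EReal) - phiDivergence φ m ν))
    = ⨅ (l : ℝ) (_ : (l : EReal) + essSupIdeal Ξ f ≤ slopeAtTop φ),
        extIntegral ν (fun ω => shiftConj φ (f ω + l)) := by
  have hext : ∀ l : ℝ, extIntegral ν (fun ω => shiftConj φ (f ω + l))
      = ((∫⁻ ω, (shiftConj φ (f ω + l)).toENNReal ∂ν : ℝ≥0∞) : EReal) := fun l =>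
    extIntegral_of_nonneg ν fun ω => shiftConj_nonneg hφ _
  have hfν := hC.integrable ν hC.self_mem
  refine le_antisymm ?_ ?_
  · refine iSup₂_le fun m hm => le_iInf₂ fun l hl => ?_
    rw [hext, phiDivergence_eq_divergence hφ]
    refine EReal.sub_le_of_le_add ?_
    have hfm := hC.integrable m hm
    have := integral_sub_integral_le φ hφ m ν (h := fun ω => f ω + l)
      (hC.measurable.add_const l) (hfm.add (integrable_const l))
      (hfν.add (integrable_const l)) (hC.ae_le_slopeAtTop hl hm)
    rw [integral_add hfm (integrable_const l), integral_add hfν (integrable_const l)] at this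
    simpa [EReal.coe_ennreal_add] using this
  · set V := ⨆ (m : ProbabilityMeasure Ω) (_ : (m : Measure Ω) ∈ C),
      (((∫ ω, f ω ∂(m : Measure Ω) - ∫ ω, f ω ∂ν : ℝ) : EReal) - phiDivergence φ m ν)
    have hV : ∀ m : ProbabilityMeasure Ω, (m : Measure Ω) ∈ C →
        ((∫ ω, f ω ∂(m : Measure Ω) - ∫ ω, f ω ∂ν : ℝ) : EReal) - phiDivergence φ m ν ≤ V :=
      fun m hm => le_iSup₂ (f := fun (m : ProbabilityMeasure Ω) (_ : (m : Measure Ω) ∈ C) =>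
        ((∫ ω, f ω ∂(m : Measure Ω) - ∫ ω, f ω ∂ν : ℝ) : EReal) - phiDivergence φ m ν) m hm
    by_cases htop : V = ⊤
    · rw [htop]; exact le_top
    -- The competitor `ν` itself has value 0.
    have hV0 : 0 ≤ V := by
      have := hV ⟨ν, inferInstance⟩ hC.self_mem
      simpa [phiDivergence_eq_divergence hφ, divergence_self hφ] using this
    obtain ⟨v, hv0, hv⟩ := EReal.exists_coe_of_nonneg_of_lt_top hV0 (lt_top_iff_ne_top.2 htop)
    obtain ⟨l, hl⟩ := hC.exists_multiplier hφ (w := v + ∫ ω, f ω ∂ν) (by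
      intro μ hμ hμ1 hD
      have := hV ⟨μ, ⟨by
        rwa [measureReal_def, ENNReal.toReal_eq_one_iff] at hμ1⟩⟩ hμ
      rw [phiDivergence_eq_divergence hφ, hv, ProbabilityMeasure.coe_mk,
        ← EReal.coe_ennreal_toReal hD] at this
      norm_cast at this
      linarith)
    refine (iInf₂_le l (hC.add_essSupIdeal_le hφ hl)).trans ?_
    rw [hext, hv]
    have := hC.lintegral_shiftConj_le hφ hl
    rw [add_sub_cancel_right] at this
    refine (EReal.coe_ennreal_le_coe_ennreal_iff.2 this).trans (le_of_eq ?_)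
    rw [EReal.coe_ennreal_ofReal]
    exact_mod_cast max_eq_left hv0

end IsAdmissibleCone

/-! ### The optimal lower bound over the probability measures of an admissible cone -/

theorem optLowerBound_le (φ : ℝ → EReal) {M : Set (ProbabilityMeasure Ω)} (g : Ω → ℝ)
    (ν : Measure Ω) {m : ProbabilityMeasure Ω} (hm : m ∈ M) :
    optLowerBound φ M g ν (∫ ω, g ω ∂(m : Measure Ω) - ∫ ω, g ω ∂ν) ≤ phiDivergence φ m ν :=
  iInf_le_of_le m (iInf_le_of_le hm (iInf_le_of_le rfl le_rfl))

theorem le_optLowerBound_iff {φ : ℝ → EReal} {M : Set (ProbabilityMeasure Ω)} {g : Ω → ℝ}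
    {ν : Measure Ω} {ε : ℝ} {c : EReal} :
    c ≤ optLowerBound φ M g ν ε ↔ ∀ m ∈ M,
      ∫ ω, g ω ∂(m : Measure Ω) - ∫ ω, g ω ∂ν = ε → c ≤ phiDivergence φ m ν := by
  simp [optLowerBound, le_iInf_iff]

theorem exists_phiDivergence_lt {φ : ℝ → EReal} {M : Set (ProbabilityMeasure Ω)} {g : Ω → ℝ}
    {ν : Measure Ω} {ε : ℝ} {c : EReal} (h : optLowerBound φ M g ν ε < c) :
    ∃ m ∈ M, ∫ ω, g ω ∂(m : Measure Ω) - ∫ ω, g ω ∂ν = ε ∧ phiDivergence φ m ν < c := by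
  by_contra! hcon
  exact absurd (le_optLowerBound_iff.2 hcon) (not_le.2 h)

/-- The supremum over `ε` of an expression containing an infimum over the fibre at `ε` is one
supremum over all of `M`. -/
theorem convexConj_optLowerBound (φ : ℝ → EReal) (M : Set (ProbabilityMeasure Ω)) (g : Ω → ℝ)
    (ν : Measure Ω) (t : ℝ) :
    convexConj (optLowerBound φ M g ν) t = ⨆ (m : ProbabilityMeasure Ω) (_ : m ∈ M),
      (((t * (∫ ω, g ω ∂(m : Measure Ω) - ∫ ω, g ω ∂ν) : ℝ) : EReal) - phiDivergence φ m ν) := by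
  refine le_antisymm ?_ (iSup₂_le fun m hm => ?_)
  · rw [convexConj_le_iff]
    intro ε a ha
    -- The infimum over a fibre need not be attained; the slack `z` provides a near-minimizer.
    rw [← EReal.ge_of_forall_gt_iff_ge]
    intro z hz
    have hz' : a < ε * t - z := by
      have : z < ε * t - a := by exact_mod_cast hz
      linarith
    obtain ⟨m, hm, hε, hD⟩ := exists_phiDivergence_lt
      (ha.trans_lt (EReal.coe_lt_coe_iff.2 hz'))
    refine le_trans ?_ (le_iSup₂ m hm)
    rw [hε]
    refine le_trans (le_of_eq ?_) (EReal.sub_le_sub le_rfl hD.le)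
    norm_cast
    ring
  · refine le_trans ?_ (le_iSup (fun ε : ℝ => ((ε * t : ℝ) : EReal) - optLowerBound φ M g ν ε)
      (∫ ω, g ω ∂(m : Measure Ω) - ∫ ω, g ω ∂ν))
    rw [mul_comm t]
    exact EReal.sub_le_sub le_rfl (optLowerBound_le φ g ν hm)

theorem dualValue_eq_biconj (φ : ℝ → EReal) (M : Set (ProbabilityMeasure Ω)) (g : Ω → ℝ)
    (ν : Measure Ω) (ε : ℝ) :
    dualValue φ M g ν ε = convexConj (convexConj (optLowerBound φ M g ν)) ε := by
  unfold dualValue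
  simp_rw [← convexConj_optLowerBound]
  rfl

theorem optLowerBound_nonneg {φ : ℝ → EReal} (hφ : IsDivergenceFunction φ)
    (M : Set (ProbabilityMeasure Ω)) (g : Ω → ℝ) (ν : Measure Ω) (ε : ℝ) :
    0 ≤ optLowerBound φ M g ν ε := by
  rw [le_optLowerBound_iff]
  intro m _ _
  rw [phiDivergence_eq_divergence hφ]
  exact EReal.coe_ennreal_nonneg _

namespace IsAdmissibleCone

variable {C : Set (Measure Ω)} {Ξ : Set (Set Ω)} {g : Ω → ℝ} {ν : Measure Ω}
  [IsProbabilityMeasure ν] {φ : ℝ → EReal} {M : Set (ProbabilityMeasure Ω)}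

/-- Mixtures of `η`-optimal measures for `x` and `y` are competitors at the mixed abscissa, and the
divergence is convex. -/
theorem convexERealFun_optLowerBound (hC : IsAdmissibleCone C Ξ g ν)
    (hφ : IsDivergenceFunction φ)
    (hM : ∀ m : ProbabilityMeasure Ω, m ∈ M ↔ (m : Measure Ω) ∈ C) :
    ConvexERealFun (optLowerBound φ M g ν) := by
  unfold ConvexERealFun
  rw [convex_iff_forall_pos]
  rintro ⟨x, u⟩ hx ⟨y, w⟩ hy a b ha hb hab
  change optLowerBound φ M g ν x ≤ (u : EReal) at hx
  change optLowerBound φ M g ν y ≤ (w : EReal) at hy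
  lift a to ℝ≥0 using ha.le
  lift b to ℝ≥0 using hb.le
  have ha0 : a ≠ 0 := by rintro rfl; simp at ha
  have hb0 : b ≠ 0 := by rintro rfl; simp at hb
  have habN : a + b = 1 := by exact_mod_cast hab
  change optLowerBound φ M g ν (a * x + b * y) ≤ ((a * u + b * w : ℝ) : EReal)
  rw [← EReal.le_of_forall_lt_iff_le]
  intro z hz
  set η := z - (a * u + b * w) with hη
  have hη0 : 0 < η := by
    have : (a * u + b * w : ℝ) < z := by exact_mod_cast hz
    linarith
  obtain ⟨m, hm, hmx, hmD⟩ := exists_phiDivergence_lt (c := ((u + η : ℝ) : EReal))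
    (lt_of_le_of_lt hx (EReal.coe_lt_coe_iff.2 (by simpa using hη0)))
  obtain ⟨m', hm', hmy, hmD'⟩ := exists_phiDivergence_lt (c := ((w + η : ℝ) : EReal))
    (lt_of_le_of_lt hy (EReal.coe_lt_coe_iff.2 (by simpa using hη0)))
  have hmC := hC.smul_mem a _ ((hM m).1 hm)
  have hmC' := hC.smul_mem b _ ((hM m').1 hm')
  have hprob : IsProbabilityMeasure (a • (m : Measure Ω) + b • (m' : Measure Ω)) := ⟨by
    simp only [Measure.add_apply, Measure.smul_apply, measure_univ, ENNReal.smul_def, smul_eq_mul,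
      mul_one]
    exact_mod_cast habN⟩
  have hmem : (⟨_, hprob⟩ : ProbabilityMeasure Ω) ∈ M := (hM _).2 (hC.add_mem _ hmC _ hmC')
  have hle := optLowerBound_le φ g ν hmem
  rw [ProbabilityMeasure.coe_mk, integral_add_measure (hC.integrable _ hmC)
    (hC.integrable _ hmC'), integral_smul_nnreal_measure, integral_smul_nnreal_measure] at hle
  have he : a • ∫ ω, g ω ∂(m : Measure Ω) + b • ∫ ω, g ω ∂(m' : Measure Ω) - ∫ ω, g ω ∂ν
      = a * x + b * y := by
    rw [← hmx, ← hmy, NNReal.smul_def, NNReal.smul_def, smul_eq_mul, smul_eq_mul]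
    linear_combination (∫ ω, g ω ∂ν) * hab
  rw [he] at hle
  refine hle.trans ?_
  rw [phiDivergence_eq_divergence hφ] at hmD hmD' ⊢
  have hD : divergence φ m ν ≠ ⊤ := fun h => by simp [h] at hmD
  have hD' : divergence φ m' ν ≠ ⊤ := fun h => by simp [h] at hmD'
  have hcombo := divergence_combo_le hφ (m : Measure Ω) (m' : Measure Ω) ν ha0 hb0 habN
  have hfin : (a : ℝ≥0∞) * divergence φ m ν + b * divergence φ m' ν ≠ ⊤ := by finiteness
  refine (EReal.coe_ennreal_le_coe_ennreal_iff.2 hcombo).trans ?_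
  rw [← EReal.coe_ennreal_toReal hfin, ENNReal.toReal_add (by finiteness) (by finiteness),
    ENNReal.toReal_mul, ENNReal.toReal_mul, ENNReal.coe_toReal, ENNReal.coe_toReal]
  rw [← EReal.coe_ennreal_toReal hD] at hmD
  rw [← EReal.coe_ennreal_toReal hD'] at hmD'
  have h1 : (divergence φ m ν).toReal < u + η := by exact_mod_cast hmD
  have h2 : (divergence φ m' ν).toReal < w + η := by exact_mod_cast hmD'
  norm_cast
  have h3 := mul_le_mul_of_nonneg_left h1.le ha.le
  have h4 := mul_le_mul_of_nonneg_left h2.le hb.le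
  have h5 : (a : ℝ) * η + b * η = η := by rw [← add_mul, hab, one_mul]
  linarith

theorem convexConj_optLowerBound_eq_cumulantGF (hC : IsAdmissibleCone C Ξ g ν)
    (hφ : IsDivergenceFunction φ)
    (hM : ∀ m : ProbabilityMeasure Ω, m ∈ M ↔ (m : Measure Ω) ∈ C) (t : ℝ) :
    convexConj (optLowerBound φ M g ν) t = cumulantGF φ ν Ξ g t := by
  rw [convexConj_optLowerBound]
  refine Eq.trans ?_ ((hC.const_mul t).iSup_sub_phiDivergence_eq hφ)
  simp_rw [hM, integral_const_mul, mul_sub]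

/-- Since `φ*(y) = ψ*(y) + y`, the subtracted terms are exactly the `ν`-integral of `t g + l`; this
identifies the two formulas for the conjugate. -/
theorem extIntegral_convexConj_sub (hC : IsAdmissibleCone C Ξ g ν)
    (hφ : IsDivergenceFunction φ) (t l : ℝ) :
    extIntegral ν (fun ω => convexConj φ (t * g ω + l)) - ((t * ∫ ω, g ω ∂ν : ℝ) : EReal)
      - (l : EReal) = extIntegral ν (fun ω => shiftConj φ (t * g ω + l)) := by
  have hm : Measurable fun ω => t * g ω + l := (hC.measurable.const_mul t).add_const l
  have hg := (hC.integrable ν hC.self_mem).const_mul t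
  have hi : Integrable (fun ω => t * g ω + l) ν := hg.add (integrable_const l)
  simp_rw [convexConj_eq_shiftConj_add]
  rw [extIntegral_add_coe (u := fun ω => shiftConj φ (t * g ω + l))
    ((measurable_shiftConj φ).comp hm) (fun ω => shiftConj_nonneg hφ _)
    hm hi, integral_add hg (integrable_const l), integral_const_mul]
  simp only [integral_const, probReal_univ, one_smul]
  rw [add_comm (t * _) l, EReal.coe_add, ← add_assoc, EReal.add_sub_cancel_right,
    EReal.add_sub_cancel_right]

end IsAdmissibleCone

/-! ### Admissible cones from decomposable pairs and from `σ`-ideals -/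

/-- The finite measures that belong to a set of signed measures. -/
def finiteMeasuresIn (X : Set (SignedMeasure Ω)) : Set (Measure Ω) :=
  {μ | ∃ _ : IsFiniteMeasure μ, μ.toSignedMeasure ∈ X}

theorem mem_probMeasures_iff (X : Set (SignedMeasure Ω)) (m : ProbabilityMeasure Ω) :
    m ∈ probMeasures X ↔ (m : Measure Ω) ∈ finiteMeasuresIn X :=
  ⟨fun h => ⟨inferInstance, h⟩, fun ⟨_, h⟩ => h⟩

theorem totalVariation_toSignedMeasure (μ : Measure Ω) [IsFiniteMeasure μ] :
    μ.toSignedMeasure.totalVariation = μ := by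
  rw [SignedMeasure.totalVariation_eq_variation, Measure.variation_toSignedMeasure]

theorem IsDecomposable.isAdmissibleCone {X : Submodule ℝ (SignedMeasure Ω)}
    {Y : Submodule ℝ (Ω → ℝ)} {ν : Measure Ω} [IsFiniteMeasure ν] (h : IsDecomposable X Y ν)
    {g : Ω → ℝ} (hg : g ∈ Y) :
    IsAdmissibleCone (finiteMeasuresIn (X : Set (SignedMeasure Ω)))
      (nullIdeal (X : Set (SignedMeasure Ω))) g ν where
  finite := fun μ ⟨hμ, _⟩ => hμ
  add_mem := by
    rintro μ ⟨hμ, hX⟩ μ' ⟨hμ', hX'⟩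
    refine ⟨inferInstance, ?_⟩
    rw [Measure.toSignedMeasure_add]
    exact X.add_mem hX hX'
  smul_mem := by
    rintro c μ ⟨hμ, hX⟩
    refine ⟨inferInstance, ?_⟩
    rw [Measure.toSignedMeasure_smul]
    exact X.smul_mem (c : ℝ) hX
  self_mem := ⟨inferInstance, h.mem⟩
  withDensity_mem := by
    rintro r hr h0 ⟨B, hB⟩
    have hlt : ∫⁻ ω, ENNReal.ofReal (r ω) ∂ν ≠ ⊤ :=
      (Integrable.lintegral_lt_top (Integrable.of_bound hr.aestronglyMeasurable B
        (ae_of_all _ fun ω => by rw [Real.norm_of_nonneg (h0 ω)]; exact hB ω))).ne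
    refine ⟨isFiniteMeasure_withDensity hlt, ?_⟩
    rw [← withDensityᵥ_toReal hr.ennreal_ofReal.aemeasurable hlt]
    simp_rw [ENNReal.toReal_ofReal (h0 _)]
    exact h.density_mem r (memLp_top_of_bound hr.aestronglyMeasurable B
      (ae_of_all _ fun ω => by rw [Real.norm_of_nonneg (h0 ω)]; exact hB ω))
  null := by
    rintro A ⟨_, hA⟩ μ ⟨hμ, hX⟩
    simpa [totalVariation_toSignedMeasure] using hA _ hX
  exists_concentrated := by
    intro A hA hAΞ
    obtain ⟨σ, hσ, h0, hne, hσA⟩ := h.exists_concentrated A hA hAΞ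
    have h0' := (VectorMeasure.le_restrict_univ_iff_le 0 σ).2 h0
    have hσeq := SignedMeasure.toMeasureOfZeroLE_toSignedMeasure σ h0'
    refine ⟨σ.toMeasureOfZeroLE univ MeasurableSet.univ h0', ⟨inferInstance, ?_⟩, ?_, ?_⟩
    · rw [hσeq]; exact hσ
    · intro hz
      apply hne
      rw [← hσeq]
      ext i hi
      simp [hz]
    · rw [← hσeq, Measure.toSignedMeasure_apply_measurable hA.compl] at hσA
      exact (measureReal_eq_zero_iff).1 hσA
  measurable := h.measurable g hg
  integrable := by
    rintro μ ⟨hμ, hX⟩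
    simpa [totalVariation_toSignedMeasure] using h.integrable _ hX g hg

theorem mem_finiteMeasuresIn_integratingMeasures {S : Set (Set Ω)} {g : Ω → ℝ} {μ : Measure Ω} :
    μ ∈ finiteMeasuresIn (integratingMeasures S g) ↔
      IsFiniteMeasure μ ∧ (∀ A ∈ S, μ A = 0) ∧ Integrable g μ := by
  constructor
  · rintro ⟨hμ, h⟩
    simpa [integratingMeasures, totalVariation_toSignedMeasure, hμ] using h
  · rintro ⟨hμ, h⟩
    exact ⟨hμ, by simpa [integratingMeasures, totalVariation_toSignedMeasure] using h⟩

theorem isAdmissibleCone_integratingMeasures (S : Set (Set Ω)) {g : Ω → ℝ} (hg : Measurable g)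
    {ν : Measure Ω} [IsFiniteMeasure ν] (hν : ν.toSignedMeasure ∈ integratingMeasures S g) :
    IsAdmissibleCone (finiteMeasuresIn (integratingMeasures S g))
      (nullIdeal (integratingMeasures S g)) g ν where
  finite := fun μ ⟨hμ, _⟩ => hμ
  add_mem := by
    intro μ hμ μ' hμ'
    rw [mem_finiteMeasuresIn_integratingMeasures] at hμ hμ' ⊢
    obtain ⟨h1, h2, h3⟩ := hμ
    obtain ⟨h1', h2', h3'⟩ := hμ'
    exact ⟨inferInstance, fun A hA => by simp [h2 A hA, h2' A hA], h3.add_measure h3'⟩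
  smul_mem := by
    intro c μ hμ
    rw [mem_finiteMeasuresIn_integratingMeasures] at hμ ⊢
    obtain ⟨h1, h2, h3⟩ := hμ
    exact ⟨inferInstance, fun A hA => by simp [h2 A hA], h3.smul_measure_nnreal⟩
  self_mem := ⟨inferInstance, hν⟩
  withDensity_mem := by
    rintro r hr h0 ⟨B, hB⟩
    have hνm : ν ∈ finiteMeasuresIn (integratingMeasures S g) := ⟨inferInstance, hν⟩
    rw [mem_finiteMeasuresIn_integratingMeasures] at hνm ⊢
    obtain ⟨-, h2, h3⟩ := hνm
    -- Domination by a multiple of `ν` gives both finiteness and integrability of `g`.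
    have hle : ν.withDensity (fun ω => ENNReal.ofReal (r ω)) ≤ ENNReal.ofReal B • ν := by
      rw [← withDensity_const]
      exact withDensity_mono (ae_of_all _ fun ω => ENNReal.ofReal_le_ofReal (hB ω))
    have : IsFiniteMeasure (ENNReal.ofReal B • ν) := Measure.smul_finite ν ENNReal.ofReal_ne_top
    exact ⟨isFiniteMeasure_of_le _ hle,
      fun A hA => withDensity_absolutelyContinuous ν _ (h2 A hA),
      (h3.smul_measure ENNReal.ofReal_ne_top).mono_measure hle⟩
  null := by
    rintro A ⟨_, hA⟩ μ ⟨hμ, hX⟩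
    simpa [totalVariation_toSignedMeasure] using hA _ hX
  exists_concentrated := by
    intro A hA hAΞ
    obtain ⟨σ, ⟨hσ1, hσ2⟩, hσA⟩ : ∃ σ ∈ integratingMeasures S g, σ.totalVariation A ≠ 0 := by
      by_contra! hcon
      exact hAΞ ⟨hA, hcon⟩
    -- Restricting the total variation of a member that charges `A` stays in the class, which is
    -- defined by domination conditions only.
    refine ⟨σ.totalVariation.restrict A, ?_, ?_, ?_⟩
    · rw [mem_finiteMeasuresIn_integratingMeasures]
      exact ⟨inferInstance, fun B hB => Measure.absolutelyContinuous_of_le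
        Measure.restrict_le_self (hσ1 B hB), hσ2.restrict⟩
    · rwa [Ne, Measure.restrict_eq_zero]
    · rw [Measure.restrict_apply hA.compl]; simp
  measurable := hg
  integrable := fun μ hμ => (mem_finiteMeasuresIn_integratingMeasures.1 hμ).2.2

end

/-! ### The main theorem -/

theorem mainTheorem3 {Ω : Type*} [MeasurableSpace Ω] (φ : ℝ → EReal)
    (hφ : IsDivergenceFunction φ) (ν : Measure Ω) [IsProbabilityMeasure ν] :
    (∀ (X : Submodule ℝ (SignedMeasure Ω)) (Y : Submodule ℝ (Ω → ℝ)), IsDecomposable X Y ν →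
      ∀ g ∈ Y, ∀ (M : Set (ProbabilityMeasure Ω)) (Ξ : Set (Set Ω)),
        M = probMeasures (X : Set (SignedMeasure Ω)) →
        Ξ = nullIdeal (X : Set (SignedMeasure Ω)) →
        -- the convex conjugate of the optimal lower bound
        (∀ t : ℝ, convexConj (optLowerBound φ M g ν) t =
          ⨅ (l : ℝ) (_ : (l : EReal) + essSupIdeal Ξ (fun ω => t * g ω) ≤ slopeAtTop φ),
            (extIntegral ν (fun ω => convexConj φ (t * g ω + l))
              - ((t * ∫ ω, g ω ∂ν : ℝ) : EReal) - (l : EReal))) ∧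
        (∀ t : ℝ, convexConj (optLowerBound φ M g ν) t = cumulantGF φ ν Ξ g t) ∧
        -- equality with the biconjugate is strong duality
        (∀ ε : ℝ, optLowerBound φ M g ν ε = convexConj (convexConj (optLowerBound φ M g ν)) ε ↔
          StrongDualityAt φ M g ν ε) ∧
        -- the optimal lower bound on the interior of its domain
        (∀ ε ∈ interior (effDomain (optLowerBound φ M g ν)),
          optLowerBound φ M g ν ε = convexConj (cumulantGF φ ν Ξ g) ε) ∧
        -- and everywhere, under lower semicontinuity, that is, strong duality
        (LowerSemicontinuous (optLowerBound φ M g ν) ↔ ∀ ε : ℝ, StrongDualityAt φ M g ν ε) ∧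
        (LowerSemicontinuous (optLowerBound φ M g ν) →
          ∀ ε : ℝ, optLowerBound φ M g ν ε = convexConj (cumulantGF φ ν Ξ g) ε)) ∧
    -- lower bounds on the divergence and upper bounds on the cumulant generating function
    (∀ (S : Set (Set Ω)), IsSigmaIdeal S → ∀ g : Ω → ℝ, Measurable g →
      ν.toSignedMeasure ∈ integratingMeasures S g →
      ∀ L : ℝ → EReal, ConvexERealFun L → LowerSemicontinuous L → (∀ x, 0 ≤ L x) →
        ((∀ μ ∈ probMeasures (integratingMeasures S g),
            L (∫ ω, g ω ∂(μ : Measure Ω) - ∫ ω, g ω ∂ν) ≤ phiDivergence φ (μ : Measure Ω) ν) ↔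
          ∀ t : ℝ, cumulantGF φ ν (nullIdeal (integratingMeasures S g)) g t ≤
            convexConj L t)) := by
  refine ⟨?_, ?_⟩
  · rintro X Y hXY g hg M Ξ rfl rfl
    have hC := hXY.isAdmissibleCone hg
    have hM := mem_probMeasures_iff (X : Set (SignedMeasure Ω))
    have hK := hC.convexConj_optLowerBound_eq_cumulantGF hφ hM
    have hKfun := funext hK
    have hconv := hC.convexERealFun_optLowerBound hφ hM
    have h0 := optLowerBound_nonneg hφ (probMeasures (X : Set (SignedMeasure Ω))) g ν
    have hSD : ∀ ε : ℝ, StrongDualityAt φ (probMeasures (X : Set (SignedMeasure Ω))) g ν ε ↔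
        optLowerBound φ (probMeasures (X : Set (SignedMeasure Ω))) g ν ε = convexConj (convexConj
          (optLowerBound φ (probMeasures (X : Set (SignedMeasure Ω))) g ν)) ε := fun ε => by
      rw [StrongDualityAt, dualValue_eq_biconj]
    refine ⟨fun t => ?_, hK, fun ε => (hSD ε).symm, fun ε hε => ?_, ⟨fun hlsc ε => ?_, fun h => ?_⟩,
      fun hlsc ε => ?_⟩
    · rw [hK]
      simp_rw [hC.extIntegral_convexConj_sub hφ]
      rfl
    · rw [← hKfun]
      exact biconj_eq_of_mem_interior hconv h0 hε
    · exact (hSD ε).2 (biconj_eq_of_lowerSemicontinuous hconv hlsc h0 ε)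
    -- Under strong duality everywhere the function is a conjugate, hence lower semicontinuous.
    · rw [funext fun ε => (hSD ε).1 (h ε)]
      exact lowerSemicontinuous_convexConj _
    · rw [← hKfun]
      exact biconj_eq_of_lowerSemicontinuous hconv hlsc h0 ε
  · intro S _ g hg hν L hL hLlsc hL0
    have hC := isAdmissibleCone_integratingMeasures S hg hν
    have hK := hC.convexConj_optLowerBound_eq_cumulantGF hφ (mem_probMeasures_iff _)
    constructor
    · intro h t
      rw [← hK]
      refine convexConj_anti (fun ε => ?_) t
      rw [le_optLowerBound_iff]
      rintro m hm rfl
      exact h m hm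
    · intro h m hm
      -- The chain is `L = L** ≤ K* ≤ optLowerBound ≤ D`, where `K` is the conjugate of
      -- `optLowerBound`.
      refine le_trans ?_ (optLowerBound_le φ g ν hm)
      rw [biconj_eq_of_lowerSemicontinuous hL hLlsc hL0]
      refine le_trans (convexConj_anti (fun t => ?_) _) (biconj_le _ _)
      rw [hK]
      exact h t
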